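/- **Setting.** For $\lambda\in\mathbb R$ let $\mathcal M_\lambda\subset\mathbb R^3$ be the surface $x^2+y^2+\lambda u^2-u=0$ (for $\lambda<0$, only its sheet through the origin) with the metric induced from $dx^2+dy^2+\lambda\,du^2$; it has constant curvature $4\lambda$ (sphere, Euclidean plane or hyperbolic plane according as $\lambda>0$, $\lambda=0$, $\lambda<0$). The map $$z\mapsto \frac{1}{1+\lambda|z|^2}\,(z,|z|^2)\in\mathbb C\times\mathbb R=\mathbb R^3,\qquad 1+\lambda|z|^2>0,$$ is inverse stereographic projection onto $\mathcal M_\lambda$ (minus one point if $\lambda>0$). Let $\Omega_\lambda$ be twice the area form, $\Omega_\lambda=\frac{2}{(1+\lambda|z|^2)^2}\,dx\wedge dy$ in the coordinate $z=x+iy$. Let $n\ge 2$ and $\kappa\neq0$. The motion of $n$ point vortices of identical vorticity $\kappa$ is the Hamiltonian flow on $\{(p_1,\dots,p_n)\in\mathcal M_\lambda^n: p_i\ne p_j \text{ for } i\neq j\}$ with symplectic form $\kappa\Omega_\lambda\oplus\dots\oplus\kappa\Omega_\lambda$ and Hamiltonian $$H_\lambda=-\frac{\kappa^2}{4\pi}\sum_{i<j}\log\frac{|z_i-z_j|^2}{(1+\lambda|z_i|^2)(1+\lambda|z_j|^2)}$$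 (the logarithm is that of the squared chordal distance $(x_i-x_j)^2+(y_i-y_j)^2+\lambda(u_i-u_j)^2$, which defines $H_\lambda$ on all of the phase space). Let $G_\lambda$ ($\cong \mathsf{SO}(3)$, $\mathsf{SE}(2)$, $\mathsf{SL}(2,\mathbb R)/\{\pm1\}$ for $\lambda>0$, $=0$, $<0$) be the group of affine bijections of $\mathbb R^3$ of determinant $1$ that preserve the function $x^2+y^2+\lambda u^2-u$ and $\mathcal M_\lambda$. The momentum map is $\mathbf J(p_1,\dots,p_n)=\kappa\sum_j p_j\in\mathbb R^3$, and $A\in G_\lambda$, $A(p)=Lp+b$, acts on momentum values by $\mu\mapsto L\mu+n\kappa b$; $G_\mu$ denotes the stabilizer of $\mu$. A trajectory with momentum $\mu$ is *Lyapunov stable* if every $G_\mu$-invariant neighbourhood $V$ of it in the phase space contains a $G_\mu$-invariant neighbourhood $U$ of it such that every trajectory that starts in $U$ exists and remains in $V$ for all time. For $r_0>0$ with $1+\lambda r_0^2>0$, the circle $|z|=r_0$ has in $\mathcal M_\lambda$ the radius $$a=\begin{cases}\lambda^{-1/2}\arctan(r_0\sqrt\lambda)&\lambda>0,\\ r_0&\lambda=0,\\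 (-\lambda)^{-1/2}\operatorname{artanh}(r_0\sqrt{-\lambda})&\lambda<0.\end{cases}$$ The regular ring of radius $a$ is the configuration given by $z_j=r_0e^{2\pi i j/n}$, $j=0,\dots,n-1$. **Theorem.** Let $n\ge2$. 1. For all $\lambda\in\mathbb R$, $\kappa\ne0$ and $r_0>0$ with $1+\lambda r_0^2>0$: if $$\frac{1+\lambda^2r_0^4}{(1+\lambda r_0^2)^2}>\frac{1}{2(n-1)}\left\lfloor\frac{n^2}{4}\right\rfloor,$$ then the regular ring of radius $a$ on $\mathcal M_\lambda$, where $a$ and $r_0$ are related as above, is a relative equilibrium (its trajectory is a rigid rotation about the $u$-axis with some constant angular velocity), and this trajectory is Lyapunov stable. 2. In particular, there is $\delta>0$, depending only on $n$, such that for all $\lambda<0$, $\kappa\neq0$ and $r_0>0$ with $-1<\lambda r_0^2<-1+\delta$ the regular ring of the corresponding radius $a$ is a Lyapunov stable relative equilibrium. -/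

import Mathlib

open scoped Topology

namespace VortexRing

/-- The ambient three-dimensional real vector space with coordinates `(x + i y, u)`. -/
abbrev Amb : Type := ℂ × ℝ

/-- The quadratic form `dx² + dy² + lam du²`. -/
noncomputable def quadForm (lam : ℝ) (v : Amb) : ℝ :=
  Complex.normSq v.1 + lam * v.2 ^ 2

/-- The function `x² + y² + lam u² - u`. -/
noncomputable def casimir (lam : ℝ) (p : Amb) : ℝ :=
  Complex.normSq p.1 + lam * p.2 ^ 2 - p.2

/-- The surface `M_lam` of constant curvature `4 lam`: the quadric `x² + y² + lam u² - u = 0`; when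
`lam < 0` only the sheet through the origin (the upper one) is kept. -/
def surface (lam : ℝ) : Set Amb :=
  {p | casimir lam p = 0 ∧ (lam < 0 → 0 ≤ p.2)}

/-- `w` is tangent at `p` to the level set of `casimir lam` through `p`. -/
def IsTangent (lam : ℝ) (p w : Amb) : Prop :=
  2 * (p.1.re * w.1.re + p.1.im * w.1.im) + (2 * lam * p.2 - 1) * w.2 = 0

/-- The inverse of stereographic projection, defined on `{z | 0 < 1 + lam |z|²}`. -/
noncomputable def stereo (lam : ℝ) (z : ℂ) : Amb :=
  (z / ((1 + lam * Complex.normSq z : ℝ) : ℂ), Complex.normSq z / (1 + lam * Complex.normSq z))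

/-- The symplectic form of `M_lam` at `p`, evaluated on tangent vectors `v`, `w`. It is twice the
Riemannian area form, `2 det (N, v, w)` with normal vector `N = (-2 lam x, -2 lam y, 1 - 2 lam u)`;
in the stereographic coordinate it reads `2 (1 + lam |z|²)⁻² dx ∧ dy`, see
`symplecticForm_stereo`. -/
noncomputable def symplecticForm (lam : ℝ) (p v w : Amb) : ℝ :=
  2 * ((-2 * lam * p.1.re) * (v.1.im * w.2 - v.2 * w.1.im)
    + (-2 * lam * p.1.im) * (v.2 * w.1.re - v.1.re * w.2)
    + (1 - 2 * lam * p.2) * (v.1.re * w.1.im - v.1.im * w.1.re))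

/-- The Green function (with constant background vorticity): the logarithm of the squared chordal
distance. In the stereographic coordinate it reads
`log (|z - w|² / ((1 + lam |z|²) (1 + lam |w|²)))`, see `green_stereo`. -/
noncomputable def green (lam : ℝ) (p q : Amb) : ℝ :=
  Real.log (quadForm lam (p - q))

/-- Configurations of `n` points on `M_lam` without collisions. -/
def phaseSpace (lam : ℝ) (n : ℕ) : Set (Fin n → Amb) :=
  {p | (∀ j, p j ∈ surface lam) ∧ Function.Injective p}

/-- The point vortex Hamiltonian, with vorticities `Γ j`. -/
noncomputable def hamiltonian {n : ℕ} (lam : ℝ) (Γ : Fin n → ℝ) (p : Fin n → Amb) : ℝ :=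
  -(1 / (4 * Real.pi)) * ∑ i, ∑ j ∈ Finset.Ioi i, Γ i * Γ j * green lam (p i) (p j)

/-- `γ` solves, on the time interval `I`, Hamilton's equations on the phase space with the
symplectic form `⨁ Γ j • Ω`: the velocity `v` satisfies `(⨁ Γ j • Ω) (v, w) = dH (w)` for all
tangent vectors `w`. (The velocity `v` is itself tangent, because `γ` stays on the surface.) -/
def IsTrajectory {n : ℕ} (lam : ℝ) (Γ : Fin n → ℝ) (I : Set ℝ) (γ : ℝ → Fin n → Amb) : Prop :=
  ∀ t ∈ I, γ t ∈ phaseSpace lam n ∧ ∃ v : Fin n → Amb, HasDerivAt γ v t ∧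
    ∀ w : Fin n → Amb, (∀ j, IsTangent lam (γ t j) (w j)) →
      ∑ j, Γ j * symplecticForm lam (γ t j) (v j) (w j)
        = fderiv ℝ (hamiltonian lam Γ) (γ t) w

/-- The symmetry group `G_lam` of `M_lam`, acting by affine maps of the ambient space: the affine
bijections of determinant one that preserve the function `x² + y² + lam u² - u` and the surface
`M_lam`. It is a copy of `SO(3)`, `SE(2)`, `SL(2, ℝ) / {± 1}` for `lam > 0`, `lam = 0`,
`lam < 0`, respectively. -/
noncomputable def symmetryGroup (lam : ℝ) : Subgroup (Amb ≃ᵃ[ℝ] Amb) where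
  carrier := {A | (∀ p, casimir lam (A p) = casimir lam p) ∧
    LinearMap.det (A.linear : Amb →ₗ[ℝ] Amb) = 1 ∧
    ∀ p, A p ∈ surface lam ↔ p ∈ surface lam}
  one_mem' := by
    refine ⟨fun p => rfl, ?_, fun p => Iff.rfl⟩
    exact LinearMap.det_id
  mul_mem' := by
    rintro A B ⟨hA1, hA2, hA3⟩ ⟨hB1, hB2, hB3⟩
    refine ⟨fun p => ?_, ?_, fun p => ?_⟩
    · exact (hA1 (B p)).trans (hB1 p)
    · have h : ((A * B).linear : Amb →ₗ[ℝ] Amb)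
          = (A.linear : Amb →ₗ[ℝ] Amb) * (B.linear : Amb →ₗ[ℝ] Amb) := rfl
      rw [h, map_mul, hA2, hB2, one_mul]
    · exact (hA3 (B p)).trans (hB3 p)
  inv_mem' := by
    rintro A ⟨hA1, hA2, hA3⟩
    have hinv : ∀ p, A (A⁻¹ p) = p := fun p => A.apply_symm_apply p
    refine ⟨fun p => ?_, ?_, fun p => ?_⟩
    · rw [← hA1, hinv]
    · have h : (A.linear : Amb →ₗ[ℝ] Amb) * ((A⁻¹).linear : Amb →ₗ[ℝ] Amb) = 1 :=
        LinearMap.ext fun v => A.linear.apply_symm_apply v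
      have h2 := congrArg LinearMap.det h
      rw [map_mul, hA2, one_mul, map_one] at h2
      exact h2
    · rw [← hA3, hinv]

/-- The momentum map: the vorticity-weighted sum of the positions in the ambient space. -/
noncomputable def momentum {n : ℕ} (Γ : Fin n → ℝ) (p : Fin n → Amb) : Amb :=
  ∑ j, Γ j • p j

/-- The affine action on momentum values for which `momentum Γ` is equivariant:
`μ ↦ L μ + (∑ j, Γ j) b` for the affine map `A : p ↦ L p + b`. -/
noncomputable def momentumAction {n : ℕ} (Γ : Fin n → ℝ) (A : Amb ≃ᵃ[ℝ] Amb) (μ : Amb) : Amb :=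
  A.linear μ + (∑ j, Γ j) • A 0

/-- `S` is invariant under the stabilizer `G_μ` of the momentum value `μ`. -/
def IsStabilizerInvariant {n : ℕ} (lam : ℝ) (Γ : Fin n → ℝ) (μ : Amb)
    (S : Set (Fin n → Amb)) : Prop :=
  ∀ A ∈ symmetryGroup lam, momentumAction Γ A μ = μ → ∀ p ∈ S, (fun j => A (p j)) ∈ S

/-- Lyapunov stability of a trajectory `γ₀`, modulo the stabilizer `G_μ` of its momentum `μ`: every
`G_μ`-invariant neighbourhood `V` (in the phase space) of the trajectory contains a `G_μ`-invariant
neighbourhood `U` of it such that every trajectory that starts in `U` exists for all time and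
remains in `V`. -/
def IsLyapunovStable {n : ℕ} (lam : ℝ) (Γ : Fin n → ℝ) (γ₀ : ℝ → Fin n → Amb) : Prop :=
  ∀ V ⊆ phaseSpace lam n, IsStabilizerInvariant lam Γ (momentum Γ (γ₀ 0)) V →
    (∀ t, V ∈ 𝓝[phaseSpace lam n] (γ₀ t)) →
    ∃ U ⊆ V, IsStabilizerInvariant lam Γ (momentum Γ (γ₀ 0)) U ∧
      (∀ t, U ∈ 𝓝[phaseSpace lam n] (γ₀ t)) ∧
      (∀ p ∈ U, ∃ γ, IsTrajectory lam Γ Set.univ γ ∧ γ 0 = p) ∧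
      ∀ (I : Set ℝ) (γ : ℝ → Fin n → Amb), IsOpen I → I.OrdConnected → 0 ∈ I →
        IsTrajectory lam Γ I γ → γ 0 ∈ U → ∀ t ∈ I, γ t ∈ V

/-- The configuration `p`, rotated about the `u`-axis with angular velocity `ω`. -/
noncomputable def rotating {n : ℕ} (ω : ℝ) (p : Fin n → Amb) (t : ℝ) : Fin n → Amb :=
  fun j => (Complex.exp (Complex.I * (ω * t : ℝ)) * (p j).1, (p j).2)

/-- `p` is a relative equilibrium, rotating rigidly about the `u`-axis, and its trajectory is
Lyapunov stable. -/
def IsStableRelativeEquilibrium {n : ℕ} (lam : ℝ) (Γ : Fin n → ℝ) (p : Fin n → Amb) : Prop :=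
  ∃ ω : ℝ, IsTrajectory lam Γ Set.univ (rotating ω p) ∧ IsLyapunovStable lam Γ (rotating ω p)

/-- The radius, measured along `M_lam`, of the circle `|z| = r` of the stereographic coordinate. -/
noncomputable def geodesicRadius (lam r : ℝ) : ℝ :=
  if 0 < lam then Real.arctan (r * √lam) / √lam
  else if lam = 0 then r
  else Real.artanh (r * √(-lam)) / √(-lam)

/-- `p` is the regular ring of `n` points about the origin, of radius `a` measured along
`M_lam`. -/
def IsRegularRing {n : ℕ} (lam a : ℝ) (p : Fin n → Amb) : Prop :=
  ∃ r : ℝ, 0 < r ∧ 0 < 1 + lam * r ^ 2 ∧ a = geodesicRadius lam r ∧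
    ∀ j : Fin n, p j = stereo lam (r * Complex.exp (2 * Real.pi * Complex.I * (j : ℕ) / n))

/-- The stereographic chart takes its values in the surface. -/
theorem stereo_mem_surface {lam : ℝ} {z : ℂ} (hz : 0 < 1 + lam * Complex.normSq z) :
    stereo lam z ∈ surface lam := by
  refine ⟨?_, fun _ => div_nonneg (Complex.normSq_nonneg z) hz.le⟩
  have h := hz.ne'
  simp only [casimir, stereo, Complex.normSq_div, Complex.normSq_ofReal]
  field_simp
  ring

/-- The Green function in the stereographic coordinate. -/
theorem green_stereo {lam : ℝ} {z w : ℂ} (hz : 0 < 1 + lam * Complex.normSq z)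
    (hw : 0 < 1 + lam * Complex.normSq w) :
    green lam (stereo lam z) (stereo lam w) = Real.log (Complex.normSq (z - w) /
      ((1 + lam * Complex.normSq z) * (1 + lam * Complex.normSq w))) := by
  have key : ∀ a b c d N M s t : ℝ, N = a * a + b * b → M = c * c + d * d → s = 1 + lam * N →
      t = 1 + lam * M → s ≠ 0 → t ≠ 0 →
      (a / s - c / t) * (a / s - c / t) + (b / s - d / t) * (b / s - d / t)
        + lam * (N / s - M / t) ^ 2 = ((a - c) * (a - c) + (b - d) * (b - d)) / (s * t) := by
    intro a b c d N M s t hN hM hs ht hs0 ht0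
    field_simp
    rw [hs, ht, hN, hM]
    ring
  unfold green
  congr 1
  have h := key z.re z.im w.re w.im _ _ _ _ (Complex.normSq_apply z) (Complex.normSq_apply w)
    rfl rfl hz.ne' hw.ne'
  simpa only [quadForm, stereo, Prod.fst_sub, Prod.snd_sub, Complex.normSq_apply (_ - _),
    Complex.sub_re, Complex.sub_im, Complex.div_ofReal_re, Complex.div_ofReal_im] using h

/-- The derivative of the stereographic chart. -/
theorem fderiv_stereo {lam : ℝ} {z : ℂ} (hz : 0 < 1 + lam * Complex.normSq z) (v : ℂ) :
    fderiv ℝ (stereo lam) z v =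
      ((((1 + lam * Complex.normSq z)⁻¹ : ℝ) : ℂ) * v
        - ((2 * lam * (z.re * v.re + z.im * v.im) / (1 + lam * Complex.normSq z) ^ 2 : ℝ) : ℂ) * z,
        2 * (z.re * v.re + z.im * v.im) / (1 + lam * Complex.normSq z) ^ 2) := by
  have hre : HasFDerivAt (fun y : ℂ => y.re) Complex.reCLM z := Complex.reCLM.hasFDerivAt
  have him : HasFDerivAt (fun y : ℂ => y.im) Complex.imCLM z := Complex.imCLM.hasFDerivAt
  have hN := (hre.mul hre).add (him.mul him)
  have hs := (hN.const_mul lam).const_add 1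
  have hz' : 1 + lam * (z.re * z.re + z.im * z.im) ≠ 0 := by
    rw [← Complex.normSq_apply]; exact hz.ne'
  have hi := (hasDerivAt_inv hz').comp_hasFDerivAt z hs
  have h := (hi.smul (hasFDerivAt_id z)).prodMk (hN.mul hi)
  have hf : stereo lam = fun y => ((1 + lam * (y.re * y.re + y.im * y.im))⁻¹ • y,
      (y.re * y.re + y.im * y.im) * (1 + lam * (y.re * y.re + y.im * y.im))⁻¹) := by
    funext y
    simp only [stereo, Complex.normSq_apply, div_eq_mul_inv, Complex.real_smul, Complex.ofReal_inv]
    rw [mul_comm]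
  have hfd := h.fderiv
  change fderiv ℝ (fun y : ℂ => ((1 + lam * (y.re * y.re + y.im * y.im))⁻¹ • y,
      (y.re * y.re + y.im * y.im) * (1 + lam * (y.re * y.re + y.im * y.im))⁻¹)) z = _ at hfd
  rw [hf, hfd]
  simp only [Complex.normSq_apply]
  refine Prod.ext (Complex.ext ?_ ?_) ?_ <;>
    simp [-Complex.ofReal_inv, -Complex.ofReal_div, -Complex.ofReal_add, -Complex.ofReal_mul,
      -Complex.ofReal_pow, -Complex.ofReal_one] <;> field_simp <;> ring

/-- The symplectic form in the stereographic coordinate is `2 (1 + lam |z|²)⁻² dx ∧ dy`. -/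
theorem symplecticForm_stereo {lam : ℝ} {z : ℂ} (hz : 0 < 1 + lam * Complex.normSq z) (v w : ℂ) :
    symplecticForm lam (stereo lam z) (fderiv ℝ (stereo lam) z v) (fderiv ℝ (stereo lam) z w)
      = 2 / (1 + lam * Complex.normSq z) ^ 2 * (v.re * w.im - v.im * w.re) := by
  have key : ∀ a b N s : ℝ, s = 1 + lam * N → N = a * a + b * b → s ≠ 0 →
      ∀ c d e f P Q : ℝ, P = 2 * (a * c + b * d) → Q = 2 * (a * e + b * f) →
      2 * ((-2 * lam * (a / s)) * ((s⁻¹ * d - lam * P / s ^ 2 * b) * (Q / s ^ 2)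
          - P / s ^ 2 * (s⁻¹ * f - lam * Q / s ^ 2 * b))
        + (-2 * lam * (b / s)) * (P / s ^ 2 * (s⁻¹ * e - lam * Q / s ^ 2 * a)
          - (s⁻¹ * c - lam * P / s ^ 2 * a) * (Q / s ^ 2))
        + (1 - 2 * lam * (N / s)) * ((s⁻¹ * c - lam * P / s ^ 2 * a) *
            (s⁻¹ * f - lam * Q / s ^ 2 * b) - (s⁻¹ * d - lam * P / s ^ 2 * b) *
            (s⁻¹ * e - lam * Q / s ^ 2 * a))) = 2 / s ^ 2 * (c * f - d * e) := by
    intro a b N s hs hN hs0 c d e f P Q hP hQ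
    field_simp
    rw [hP, hQ, hs, hN]
    ring
  have h := key z.re z.im _ _ rfl (Complex.normSq_apply z) hz.ne' v.re v.im w.re w.im _ _ rfl rfl
  rw [← h, fderiv_stereo hz, fderiv_stereo hz]
  simp only [symplecticForm, stereo, Complex.div_ofReal_re, Complex.div_ofReal_im, Complex.sub_re,
    Complex.sub_im, Complex.re_ofReal_mul, Complex.im_ofReal_mul]
  ring

end VortexRing

/-! The energy and the total height `∑ u_j` are both conserved, and the rotation about the `u`-axis
is the Hamiltonian flow of `-u` on each factor. At the ring `dH` is a multiple of `d(∑ u_j)` on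
tangent vectors, so the ring rotates rigidly (`isTrajectory_rotating_ring`). The combination of the
two that is critical at the ring is the function `lyapunov`. It is shown to have a strict local
minimum there modulo rotations; no restriction to a momentum level is needed.

In the coordinates `z_j = r ζ_j exp (s_j + i t_j)`, with `ζ_j` the `n`-th roots of unity, it splits
up to a constant into pair terms `-log (cosh (s_i - s_j) - cos (θ_i - θ_j + t_i - t_j))` and
single-vortex terms (`lyapunov_eq_polarLyapunov`). The pair terms are convex to second order in the
angular differences, but contribute `-(s_i - s_j)² / (2 (1 - cos (θ_i - θ_j)))` radially. The sum of
these losses is a circulant form with Fourier eigenvalues proportional to `k (n - k)`, so it is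
controlled by `⌊n² / 4⌋` (`sum_sq_sub_div_normSq_le`). Each single-vortex term has second derivative
`2 (n - 1) (1 + x²) / (1 + x)²` with `x = lam r²` (`eventually_radial_le`). The criterion says
exactly that this gain exceeds the loss (`eventually_polarLyapunov_le`).

Stability follows by trapping: a trajectory that starts in a small tube around the rotation orbit,
at a Lyapunov value below the minimum on the tube's boundary, cannot leave
(`infDist_lt_of_lyapunov_const`), and hence exists for all time (`exists_isTrajectory`). The
criterion also excludes `lam r² = 1`; otherwise the angular velocity would vanish and the stabilizer
of the momentum would be larger than the rotations about the axis. -/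

namespace VortexRing

/-! ### Chordal distance, Hamilton's equations and conserved quantities. -/

/-- The bilinear form associated with `quadForm`. -/
noncomputable def bilin (lam : ℝ) (v w : Amb) : ℝ :=
  v.1.re * w.1.re + v.1.im * w.1.im + lam * (v.2 * w.2)

theorem quadForm_neg (lam : ℝ) (v : Amb) : quadForm lam (-v) = quadForm lam v := by
  simp [quadForm]

theorem quadForm_sub_comm (lam : ℝ) (p q : Amb) :
    quadForm lam (p - q) = quadForm lam (q - p) := by
  rw [← quadForm_neg, neg_sub]

theorem continuous_quadForm (lam : ℝ) : Continuous (quadForm lam) := by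
  unfold quadForm
  have := Complex.continuous_normSq
  fun_prop

theorem continuous_casimir (lam : ℝ) : Continuous (casimir lam) := by
  unfold casimir
  have := Complex.continuous_normSq
  fun_prop

/-- The chordal distance separates the points of the surface. -/
theorem quadForm_sub_pos {lam : ℝ} {p q : Amb} (hp : p ∈ surface lam) (hq : q ∈ surface lam)
    (hpq : p ≠ q) : 0 < quadForm lam (p - q) := by
  obtain ⟨z, u⟩ := p
  obtain ⟨w, v⟩ := q
  obtain ⟨hp1, hp2⟩ := hp
  obtain ⟨hq1, hq2⟩ := hq
  simp only [casimir, Complex.normSq_apply] at hp1 hq1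
  simp only at hp2 hq2
  simp only [quadForm, Prod.fst_sub, Prod.snd_sub, Complex.normSq_apply, Complex.sub_re,
    Complex.sub_im]
  by_contra hcon
  push Not at hcon
  have huv : u = v := by
    rcases lt_or_ge lam 0 with hl | hl
    · have hu := hp2 hl
      have hv := hq2 hl
      have hT : 0 ≤ u + v - 2 * lam * u * v := by
        have := mul_nonneg hu hv
        nlinarith
      -- For `lam < 0` the form is indefinite and a reversed Cauchy–Schwarz argument is used. A
      -- nonpositive value gives `u + v - 2 lam u v ≤ 2 D`, while Cauchy–Schwarz in the plane bounds
      -- `D²` by `|z|² |w|²`. After squaring, everything cancels except `(u - v)² ≤ 0`.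
      set D := z.re * w.re + z.im * w.im with hD
      have h1 : u + v - 2 * lam * u * v ≤ 2 * D := by
        rw [hD]; nlinarith
      have h2 : D ^ 2 ≤ (u - lam * u ^ 2) * (v - lam * v ^ 2) := by
        have e1 : u - lam * u ^ 2 = z.re * z.re + z.im * z.im := by linarith
        have e2 : v - lam * v ^ 2 = w.re * w.re + w.im * w.im := by linarith
        rw [e1, e2, hD]
        nlinarith [sq_nonneg (z.re * w.im - z.im * w.re)]
      have h3 : (u + v - 2 * lam * u * v) ^ 2 ≤ (2 * D) ^ 2 := pow_le_pow_left₀ hT h1 2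
      have h4 : (u - v) ^ 2 ≤ 0 := by nlinarith
      nlinarith [sq_nonneg (u - v), pow_eq_zero_iff (two_ne_zero) |>.1 (le_antisymm h4 (sq_nonneg _))]
    · have h0 : (z.re - w.re) * (z.re - w.re) + (z.im - w.im) * (z.im - w.im) ≤ 0 := by
        nlinarith [mul_nonneg hl (sq_nonneg (u - v))]
      have hre : z.re = w.re := by nlinarith [sq_nonneg (z.re - w.re), sq_nonneg (z.im - w.im)]
      have him : z.im = w.im := by nlinarith [sq_nonneg (z.re - w.re), sq_nonneg (z.im - w.im)]
      rcases hl.eq_or_lt with rfl | hl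
      · rw [hre, him] at hp1
        linarith
      · have : lam * (u - v) ^ 2 ≤ 0 := by
          rw [hre, him] at hcon; linarith
        exact sub_eq_zero.1 (pow_eq_zero_iff two_ne_zero |>.1 (le_antisymm
          (nonpos_of_mul_nonpos_right this hl) (sq_nonneg (u - v))))
  subst huv
  have hre : z.re = w.re := by nlinarith [sq_nonneg (z.re - w.re), sq_nonneg (z.im - w.im)]
  have him : z.im = w.im := by nlinarith [sq_nonneg (z.re - w.re), sq_nonneg (z.im - w.im)]
  exact hpq (Prod.ext (Complex.ext hre him) rfl)

theorem phaseSpace_quadForm_ne {lam : ℝ} {n : ℕ} {p : Fin n → Amb} (hp : p ∈ phaseSpace lam n)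
    {i j : Fin n} (hij : i ≠ j) : quadForm lam (p i - p j) ≠ 0 :=
  (quadForm_sub_pos (hp.1 i) (hp.1 j) (hp.2.ne hij)).ne'

theorem hasFDerivAt_quadForm (lam : ℝ) (v : Amb) :
    ∃ L : Amb →L[ℝ] ℝ, HasFDerivAt (quadForm lam) L v ∧ ∀ w, L w = 2 * bilin lam v w := by
  have hre : HasFDerivAt (fun y : Amb => y.1.re)
      (Complex.reCLM.comp (ContinuousLinearMap.fst ℝ ℂ ℝ)) v :=
    (Complex.reCLM.comp (ContinuousLinearMap.fst ℝ ℂ ℝ)).hasFDerivAt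
  have him : HasFDerivAt (fun y : Amb => y.1.im)
      (Complex.imCLM.comp (ContinuousLinearMap.fst ℝ ℂ ℝ)) v :=
    (Complex.imCLM.comp (ContinuousLinearMap.fst ℝ ℂ ℝ)).hasFDerivAt
  have hu : HasFDerivAt (fun y : Amb => y.2) (ContinuousLinearMap.snd ℝ ℂ ℝ) v :=
    (ContinuousLinearMap.snd ℝ ℂ ℝ).hasFDerivAt
  have h := ((hre.mul hre).add (him.mul him)).add ((hu.mul hu).const_mul lam)
  refine ⟨_, h.congr_of_eventuallyEq (Filter.Eventually.of_forall fun y => ?_), fun w => ?_⟩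
  · simp [quadForm, Complex.normSq_apply, sq]
  · simp [bilin]
    ring

theorem hasFDerivAt_hamiltonian {lam : ℝ} {n : ℕ} (Γ : Fin n → ℝ) {p : Fin n → Amb}
    (hp : ∀ i j, i ≠ j → quadForm lam (p i - p j) ≠ 0) :
    ∃ L : (Fin n → Amb) →L[ℝ] ℝ, HasFDerivAt (hamiltonian lam Γ) L p ∧
      ∀ w, L w = -(1 / (4 * Real.pi)) * ∑ i, ∑ j ∈ Finset.Ioi i, Γ i * Γ j *
        (2 * bilin lam (p i - p j) (w i - w j) / quadForm lam (p i - p j)) := by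
  have hg : ∀ i j : Fin n, j ∈ Finset.Ioi i → ∃ L : (Fin n → Amb) →L[ℝ] ℝ,
      HasFDerivAt (fun p : Fin n → Amb => green lam (p i) (p j)) L p ∧
      ∀ w, L w = 2 * bilin lam (p i - p j) (w i - w j) / quadForm lam (p i - p j) := by
    intro i j hij
    obtain ⟨L, hL, hLw⟩ := hasFDerivAt_quadForm lam (p i - p j)
    have h1 : HasFDerivAt (fun p : Fin n → Amb => p i - p j)
        (ContinuousLinearMap.proj (R := ℝ) (φ := fun _ : Fin n => Amb) i -
          ContinuousLinearMap.proj (R := ℝ) (φ := fun _ : Fin n => Amb) j) p :=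
      ((ContinuousLinearMap.proj (R := ℝ) (φ := fun _ : Fin n => Amb) i).hasFDerivAt).sub
        ((ContinuousLinearMap.proj (R := ℝ) (φ := fun _ : Fin n => Amb) j).hasFDerivAt)
    have h2 := (hL.comp p h1).log (by exact hp i j (Finset.mem_Ioi.1 hij).ne)
    refine ⟨_, h2, fun w => ?_⟩
    have h3 : L (w i - w j) = 2 * bilin lam (p i - p j) (w i - w j) := hLw _
    rw [map_sub] at h3
    simp [h3]
    ring
  choose! L hL hLw using hg
  have h := (HasFDerivAt.fun_sum fun i (_ : i ∈ Finset.univ) =>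
    HasFDerivAt.fun_sum fun j (hj : j ∈ Finset.Ioi i) => (hL i j hj).const_mul (Γ i * Γ j)).const_mul
      (-(1 / (4 * Real.pi)))
  refine ⟨_, h, fun w => ?_⟩
  simp only [_root_.smul_apply, _root_.sum_apply, smul_eq_mul]
  congr 1
  refine Finset.sum_congr rfl fun i _ => Finset.sum_congr rfl fun j hj => ?_
  rw [hLw i j hj]

/-- A symmetric sum over pairs of indices, in terms of the sum over ordered pairs. -/
theorem sum_Ioi_add_eq {n : ℕ} {M : Type*} [AddCommMonoid M] (f : Fin n → Fin n → M) :
    ∑ i, ∑ j ∈ Finset.Ioi i, (f i j + f j i) = ∑ i, ∑ j ∈ Finset.univ.erase i, f i j := by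
  have hsplit : ∀ i : Fin n, Finset.univ.erase i = (Finset.Ioi i).disjUnion (Finset.Iio i)
      (Finset.disjoint_left.2 fun a h1 h2 =>
        lt_asymm (Finset.mem_Ioi.1 h1) (Finset.mem_Iio.1 h2)) := by
    intro i
    ext j
    simp only [Finset.mem_erase, Finset.mem_univ, and_true, Finset.mem_disjUnion, Finset.mem_Ioi,
      Finset.mem_Iio]
    exact ⟨fun h => (lt_or_gt_of_ne h).symm, fun h => h.elim ne_of_gt ne_of_lt⟩
  simp_rw [hsplit, Finset.sum_disjUnion, Finset.sum_add_distrib]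
  congr 1
  exact Finset.sum_comm' fun i j => by simp

/-- The derivative of the Hamiltonian for identical vorticities. -/
theorem fderiv_hamiltonian {lam κ : ℝ} {n : ℕ} {p : Fin n → Amb}
    (hp : ∀ i j, i ≠ j → quadForm lam (p i - p j) ≠ 0) (w : Fin n → Amb) :
    fderiv ℝ (hamiltonian lam fun _ => κ) p w = -(κ ^ 2 / (4 * Real.pi)) *
      ∑ j, ∑ i ∈ Finset.univ.erase j,
        2 * bilin lam (p j - p i) (w j) / quadForm lam (p j - p i) := by
  obtain ⟨L, hL, hLw⟩ := hasFDerivAt_hamiltonian (fun _ => κ) hp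
  rw [hL.fderiv, hLw, ← sum_Ioi_add_eq, Finset.mul_sum, Finset.mul_sum]
  refine Finset.sum_congr rfl fun i _ => ?_
  rw [Finset.mul_sum, Finset.mul_sum]
  refine Finset.sum_congr rfl fun j _ => ?_
  rw [quadForm_sub_comm lam (p j) (p i), ← add_div]
  have : 2 * bilin lam (p i - p j) (w i - w j)
      = 2 * bilin lam (p i - p j) (w i) + 2 * bilin lam (p j - p i) (w j) := by
    simp [bilin]; ring
  rw [this]
  ring

theorem isTangent_of_hasDerivAt {lam : ℝ} {γ : ℝ → Amb} {v : Amb} {t : ℝ}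
    (hγ : HasDerivAt γ v t) (h : ∀ᶠ s in 𝓝 t, casimir lam (γ s) = 0) :
    IsTangent lam (γ t) v := by
  have h0 : HasDerivAt (fun s => casimir lam (γ s)) 0 t :=
    (hasDerivAt_const t (0 : ℝ)).congr_of_eventuallyEq h
  have hre : HasDerivAt (fun s => (γ s).1.re) v.1.re t :=
    (Complex.reCLM.comp (ContinuousLinearMap.fst ℝ ℂ ℝ)).hasFDerivAt.comp_hasDerivAt t hγ
  have him : HasDerivAt (fun s => (γ s).1.im) v.1.im t :=
    (Complex.imCLM.comp (ContinuousLinearMap.fst ℝ ℂ ℝ)).hasFDerivAt.comp_hasDerivAt t hγ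
  have hu : HasDerivAt (fun s => (γ s).2) v.2 t :=
    (ContinuousLinearMap.snd ℝ ℂ ℝ).hasFDerivAt.comp_hasDerivAt t hγ
  have h1 := (((hre.mul hre).add (him.mul him)).add ((hu.mul hu).const_mul lam)).sub hu
  have h2 : (fun s => casimir lam (γ s)) =
      (fun s => (γ s).1.re * (γ s).1.re + (γ s).1.im * (γ s).1.im + lam * ((γ s).2 * (γ s).2)
        - (γ s).2) := by
    funext s; simp [casimir, Complex.normSq_apply, sq]
  rw [h2] at h0
  have := h1.unique h0
  unfold IsTangent
  linarith

theorem hasDerivAt_casimir {lam : ℝ} {γ : ℝ → Amb} {v : Amb} {t : ℝ}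
    (hγ : HasDerivAt γ v t) (h : IsTangent lam (γ t) v) :
    HasDerivAt (fun s => casimir lam (γ s)) 0 t := by
  have hre : HasDerivAt (fun s => (γ s).1.re) v.1.re t :=
    (Complex.reCLM.comp (ContinuousLinearMap.fst ℝ ℂ ℝ)).hasFDerivAt.comp_hasDerivAt t hγ
  have him : HasDerivAt (fun s => (γ s).1.im) v.1.im t :=
    (Complex.imCLM.comp (ContinuousLinearMap.fst ℝ ℂ ℝ)).hasFDerivAt.comp_hasDerivAt t hγ
  have hu : HasDerivAt (fun s => (γ s).2) v.2 t :=
    (ContinuousLinearMap.snd ℝ ℂ ℝ).hasFDerivAt.comp_hasDerivAt t hγ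
  have h1 := (((hre.mul hre).add (him.mul him)).add ((hu.mul hu).const_mul lam)).sub hu
  have h2 : (fun s => casimir lam (γ s)) =
      (fun s => (γ s).1.re * (γ s).1.re + (γ s).1.im * (γ s).1.im + lam * ((γ s).2 * (γ s).2)
        - (γ s).2) := by
    funext s; simp [casimir, Complex.normSq_apply, sq]
  rw [h2]
  refine h1.congr_deriv ?_
  unfold IsTangent at h
  linarith

theorem symplecticForm_self (lam : ℝ) (p v : Amb) : symplecticForm lam p v v = 0 := by
  simp only [symplecticForm]; ring

theorem symplecticForm_swap (lam : ℝ) (p v w : Amb) :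
    symplecticForm lam p v w = -symplecticForm lam p w v := by
  simp only [symplecticForm]; ring

theorem symplecticForm_smul (lam c : ℝ) (p v w : Amb) :
    symplecticForm lam p (c • v) w = c * symplecticForm lam p v w := by
  simp [symplecticForm]; ring

theorem symplecticForm_sum {ι : Type*} (s : Finset ι) (lam : ℝ) (p : Amb) (v : ι → Amb) (w : Amb) :
    symplecticForm lam p (∑ i ∈ s, v i) w = ∑ i ∈ s, symplecticForm lam p (v i) w := by
  classical
  induction s using Finset.induction_on with
  | empty => simp [symplecticForm]
  | insert a s ha ih =>
    rw [Finset.sum_insert ha, Finset.sum_insert ha, ← ih]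
    simp only [symplecticForm, Prod.fst_add, Prod.snd_add, Complex.add_re, Complex.add_im]
    ring

/-- The rotation about the `u`-axis is generated by `-u`. -/
theorem symplecticForm_rotation {lam : ℝ} {p w : Amb} (hp : casimir lam p = 0)
    (hw : IsTangent lam p w) (ω : ℝ) :
    symplecticForm lam p (Complex.I * ω * p.1, 0) w = -ω * w.2 := by
  simp only [casimir, Complex.normSq_apply, IsTangent, symplecticForm] at *
  simp
  linear_combination (-4 * lam * ω * w.2) * hp - ω * (1 - 2 * lam * p.2) * hw

theorem isTangent_rotation (lam : ℝ) (p : Amb) (ω : ℝ) :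
    IsTangent lam p (Complex.I * ω * p.1, 0) := by
  simp [IsTangent]; ring

/-- The tangent vector at `p` that the symplectic form pairs with `w` to `2 * bilin lam d w`. -/
noncomputable def turn (lam : ℝ) (p d : Amb) : Amb :=
  (Complex.I * (((2 * lam * p.2 - 1 : ℝ) : ℂ) * d.1 - ((2 * lam * d.2 : ℝ) : ℂ) * p.1),
    2 * (p.1.re * d.1.im - p.1.im * d.1.re))

theorem isTangent_turn (lam : ℝ) (p d : Amb) : IsTangent lam p (turn lam p d) := by
  simp [IsTangent, turn]; ring

/-- Modulo tangency of `w`, the left side is `2 * bilin lam d w` times `(1 - 2 lam u)² + 4 lam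
|z|²`, and this factor equals `1` on the surface. Since `dH` is a combination of such pairings, this
yields an explicit Hamiltonian vector field. -/
theorem symplecticForm_turn {lam : ℝ} {p w : Amb} (d : Amb) (hp : casimir lam p = 0)
    (hw : IsTangent lam p w) :
    symplecticForm lam p (turn lam p d) w = 2 * bilin lam d w := by
  simp only [casimir, Complex.normSq_apply, IsTangent, symplecticForm, turn, bilin] at *
  simp only [Complex.mul_re, Complex.mul_im, Complex.I_re, Complex.I_im, Complex.sub_re,
    Complex.sub_im, Complex.ofReal_re, Complex.ofReal_im]
  linear_combination 8 * lam * (d.1.re * w.1.re + d.1.im * w.1.im + lam * (d.2 * w.2)) * hp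
    - 2 * (2 * lam * (p.1.re * d.1.re + p.1.im * d.1.im) + (2 * lam * p.2 - 1) * lam * d.2) * hw

/-- `v` satisfies Hamilton's equations at `p`, and is tangent to the phase space. -/
def IsHamiltonianVector {n : ℕ} (lam κ : ℝ) (p v : Fin n → Amb) : Prop :=
  (∀ j, IsTangent lam (p j) (v j)) ∧ ∀ w : Fin n → Amb, (∀ j, IsTangent lam (p j) (w j)) →
    ∑ j, κ * symplecticForm lam (p j) (v j) (w j) = fderiv ℝ (hamiltonian lam fun _ => κ) p w

theorem IsHamiltonianVector.fderiv_self {n : ℕ} {lam κ : ℝ} {p v : Fin n → Amb}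
    (h : IsHamiltonianVector lam κ p v) : fderiv ℝ (hamiltonian lam fun _ => κ) p v = 0 := by
  rw [← h.2 v h.1]
  simp [symplecticForm_self]

/-- Noether's theorem for the rotations about the `u`-axis: testing Hamilton's equations against the
rotation field gives the rate of change of the total height on one side, and on the other the
derivative of `H` along a rotation, which is zero. -/
theorem IsHamiltonianVector.sum_snd {n : ℕ} {lam κ : ℝ} (hκ : κ ≠ 0) {p v : Fin n → Amb}
    (hp : ∀ j, casimir lam (p j) = 0) (hq : ∀ i j, i ≠ j → quadForm lam (p i - p j) ≠ 0)
    (h : IsHamiltonianVector lam κ p v) : ∑ j, (v j).2 = 0 := by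
  have h1 := h.2 (fun j => (Complex.I * (1 : ℝ) * (p j).1, 0))
    fun j => isTangent_rotation lam (p j) 1
  have h2 : ∀ j, κ * symplecticForm lam (p j) (v j) (Complex.I * (1 : ℝ) * (p j).1, 0)
      = κ * (v j).2 := by
    intro j
    rw [symplecticForm_swap, symplecticForm_rotation (hp j) (h.1 j)]
    ring
  simp only [h2] at h1
  rw [← Finset.mul_sum] at h1
  obtain ⟨L, hL, hLw⟩ := hasFDerivAt_hamiltonian (fun _ => κ) hq
  rw [hL.fderiv, hLw] at h1
  have h3 : ∀ i j, bilin lam (p i - p j) ((Complex.I * (1 : ℝ) * (p i).1, (0 : ℝ))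
      - (Complex.I * (1 : ℝ) * (p j).1, (0 : ℝ))) = 0 := by
    intro i j
    simp [bilin]; ring
  simp only [h3] at h1
  simpa [hκ] using h1

/-- The vector field of the motion, extended to the ambient space. -/
noncomputable def vectorField {n : ℕ} (lam κ : ℝ) (p : Fin n → Amb) (j : Fin n) : Amb :=
  ∑ i ∈ Finset.univ.erase j,
    (-(κ / (4 * Real.pi)) / quadForm lam (p j - p i)) • turn lam (p j) (p j - p i)

theorem isTangent_sum {ι : Type*} (s : Finset ι) {lam : ℝ} {p : Amb} {v : ι → Amb} (c : ι → ℝ)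
    (h : ∀ i ∈ s, IsTangent lam p (v i)) : IsTangent lam p (∑ i ∈ s, c i • v i) := by
  classical
  induction s using Finset.induction_on with
  | empty => simp [IsTangent]
  | insert a s ha ih =>
    rw [Finset.sum_insert ha]
    have h1 := ih fun i hi => h i (Finset.mem_insert_of_mem hi)
    have h2 := h a (Finset.mem_insert_self a s)
    simp only [IsTangent, Prod.fst_add, Prod.snd_add, Complex.add_re, Complex.add_im, Prod.smul_fst,
      Prod.smul_snd, Complex.real_smul, Complex.re_ofReal_mul, Complex.im_ofReal_mul,
      smul_eq_mul] at h1 h2 ⊢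
    linear_combination h1 + c a * h2

theorem isHamiltonianVector_vectorField {n : ℕ} {lam κ : ℝ} {p : Fin n → Amb}
    (hp : ∀ j, casimir lam (p j) = 0) (hq : ∀ i j, i ≠ j → quadForm lam (p i - p j) ≠ 0) :
    IsHamiltonianVector lam κ p (vectorField lam κ p) := by
  refine ⟨fun j => isTangent_sum _ _ fun i _ => isTangent_turn lam _ _, fun w hw => ?_⟩
  rw [fderiv_hamiltonian hq, Finset.mul_sum]
  refine Finset.sum_congr rfl fun j _ => ?_
  rw [vectorField, symplecticForm_sum, Finset.mul_sum, Finset.mul_sum]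
  refine Finset.sum_congr rfl fun i _ => ?_
  rw [symplecticForm_smul, symplecticForm_turn _ (hp j) (hw j)]
  ring

/-- The configurations without collisions, as an open set of the ambient space. -/
def noCollision (lam : ℝ) (n : ℕ) : Set (Fin n → Amb) :=
  {p | ∀ i j, i ≠ j → quadForm lam (p i - p j) ≠ 0}

theorem isOpen_noCollision (lam : ℝ) (n : ℕ) : IsOpen (noCollision lam n) := by
  have : noCollision lam n = ⋂ i, ⋂ j, {p | i ≠ j → quadForm lam (p i - p j) ≠ 0} := by
    ext p; simp [noCollision]
  rw [this]
  refine isOpen_iInter_of_finite fun i => isOpen_iInter_of_finite fun j => ?_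
  by_cases hij : i = j
  · simp [hij]
  · simp only [ne_eq, hij, not_false_eq_true, forall_const]
    have hc : Continuous fun p : Fin n → Amb => quadForm lam (p i - p j) :=
      (continuous_quadForm lam).comp (by fun_prop)
    exact isOpen_ne_fun hc continuous_const

theorem contDiff_quadForm (lam : ℝ) : ContDiff ℝ 1 (quadForm lam) := by
  have : quadForm lam = fun v : Amb => Complex.reCLM v.1 * Complex.reCLM v.1
      + Complex.imCLM v.1 * Complex.imCLM v.1 + lam * v.2 ^ 2 := by
    funext v; simp [quadForm, Complex.normSq_apply]
  rw [this]
  fun_prop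

theorem contDiffOn_vectorField {n : ℕ} (lam κ : ℝ) :
    ContDiffOn ℝ 1 (vectorField (n := n) lam κ) (noCollision lam n) := by
  refine contDiffOn_pi.2 fun j => ?_
  unfold vectorField
  refine ContDiffOn.sum fun i hi => ?_
  have hq : ContDiff ℝ 1 fun p : Fin n → Amb => quadForm lam (p j - p i) :=
    (contDiff_quadForm lam).comp (by fun_prop)
  refine (contDiffOn_const.div hq.contDiffOn fun p (hp : p ∈ noCollision lam n) =>
    hp j i (Finset.ne_of_mem_erase hi).symm).smul (ContDiff.contDiffOn ?_)
  have ht : (fun p : Fin n → Amb => turn lam (p j) (p j - p i)) = fun p =>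
      (Complex.I * (Complex.ofRealCLM (2 * lam * (p j).2 - 1) * (p j - p i).1
        - Complex.ofRealCLM (2 * lam * (p j - p i).2) * (p j).1),
      2 * (Complex.reCLM (p j).1 * Complex.imCLM (p j - p i).1
        - Complex.imCLM (p j).1 * Complex.reCLM (p j - p i).1)) := by
    funext p; simp [turn]
  rw [ht]
  fun_prop

end VortexRing

/-! ### Roots of unity and the discrete Fourier transform. -/

namespace VortexRing

open Complex ComplexConjugate

/-- The vertices of the regular `n`-gon inscribed in the unit circle. -/
noncomputable def root (n : ℕ) (j : Fin n) : ℂ :=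
  exp (2 * Real.pi * I * (j : ℕ) / n)

theorem root_eq_exp_angle (n : ℕ) (j : Fin n) :
    root n j = exp (((2 * Real.pi * (j : ℕ) / n : ℝ) : ℂ) * I) := by
  rw [root]; congr 1; push_cast; ring

theorem root_eq_pow (n : ℕ) (j : Fin n) : root n j = exp (2 * Real.pi * I / n) ^ (j : ℕ) := by
  rw [root, ← exp_nat_mul]; congr 1; ring

theorem norm_root (n : ℕ) (j : Fin n) : ‖root n j‖ = 1 := by
  rw [root_eq_exp_angle, norm_exp_ofReal_mul_I]

theorem normSq_root (n : ℕ) (j : Fin n) : normSq (root n j) = 1 := by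
  rw [normSq_eq_norm_sq, norm_root, one_pow]

theorem root_ne_zero (n : ℕ) (j : Fin n) : root n j ≠ 0 := exp_ne_zero _

theorem root_mul_conj (n : ℕ) (j : Fin n) : root n j * conj (root n j) = 1 := by
  rw [mul_conj, normSq_root, ofReal_one]

theorem root_pow_comm (n : ℕ) (j k : Fin n) : root n j ^ (k : ℕ) = root n k ^ (j : ℕ) := by
  rw [root_eq_pow, root_eq_pow, ← pow_mul, ← pow_mul, mul_comm (j : ℕ)]

variable {n : ℕ} [NeZero n]

theorem root_injective : Function.Injective (root n) := by
  intro i j hij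
  rw [root_eq_pow, root_eq_pow] at hij
  exact Fin.ext ((isPrimitiveRoot_exp n (NeZero.ne n)).pow_inj i.2 j.2 hij)

theorem root_pow_card (j : Fin n) : root n j ^ n = 1 := by
  rw [root_eq_pow, ← pow_mul, mul_comm (j : ℕ), pow_mul, (isPrimitiveRoot_exp n (NeZero.ne n)).pow_eq_one,
    one_pow]

theorem root_zero : root n 0 = 1 := by simp [root]

theorem root_add (i j : Fin n) : root n (i + j) = root n i * root n j := by
  rw [root_eq_pow, root_eq_pow, root_eq_pow, ← pow_add, Fin.val_add]
  have h := (isPrimitiveRoot_exp n (NeZero.ne n)).pow_eq_one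
  conv_rhs => rw [← Nat.mod_add_div ((i : ℕ) + j) n, pow_add, pow_mul, h, one_pow, mul_one]

theorem root_neg (j : Fin n) : root n (-j) = conj (root n j) := by
  refine mul_left_cancel₀ (root_ne_zero n j) ?_
  rw [root_mul_conj, ← root_add, add_neg_cancel, root_zero]

theorem root_sub (i j : Fin n) : root n (i - j) = root n i * conj (root n j) := by
  rw [sub_eq_add_neg, root_add, root_neg]

/-- Reflection of the indices in the sum over all vertices other than the `i`-th. -/
theorem sum_erase_reflect {M : Type*} [AddCommMonoid M] (f : Fin n → M) (i : Fin n) :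
    ∑ j ∈ Finset.univ.erase i, f (i + i - j) = ∑ j ∈ Finset.univ.erase i, f j := by
  refine Finset.sum_bij' (fun j _ => i + i - j) (fun j _ => i + i - j) ?_ ?_ ?_ ?_ ?_
  · intro j hj
    simp only [Finset.mem_erase, Finset.mem_univ, and_true, ne_eq] at hj ⊢
    intro h
    exact hj (by rw [sub_eq_iff_eq_add] at h; exact (add_left_cancel h).symm)
  · intro j hj
    simp only [Finset.mem_erase, Finset.mem_univ, and_true, ne_eq] at hj ⊢
    intro h
    exact hj (by rw [sub_eq_iff_eq_add] at h; exact (add_left_cancel h).symm)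
  · intro j _; simp
  · intro j _; simp
  · intro j _; rfl

theorem conj_root_sub_root_ne_zero {i j : Fin n} (h : i ≠ j) :
    conj (root n i - root n j) ≠ 0 := by
  rw [Ne, map_eq_zero, sub_eq_zero]
  exact fun h' => h (root_injective h')

/-- Reflection in the line through `root n j` pairs the index `i` with `2 j - i`, and the two
corresponding terms add up to `root n j`. The sum is what the other vertices of the ring contribute
at the `j`-th. -/
theorem sum_inv_conj_root_sub (j : Fin n) :
    ∑ i ∈ Finset.univ.erase j, (conj (root n j - root n i))⁻¹ = (n - 1) / 2 * root n j := by
  have h2 : ∑ i ∈ Finset.univ.erase j, ((conj (root n j - root n i))⁻¹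
      + (conj (root n j - root n (j + j - i)))⁻¹) = (n - 1) * root n j := by
    have : ∀ i ∈ Finset.univ.erase j, ((conj (root n j - root n i))⁻¹
      + (conj (root n j - root n (j + j - i)))⁻¹) = root n j := by
      intro i hi
      have hij : j ≠ i := (Finset.ne_of_mem_erase hi).symm
      have h0 := conj_root_sub_root_ne_zero hij
      have h1 : j ≠ j + j - i := by
        intro h
        rw [eq_sub_iff_add_eq] at h
        exact hij (add_left_cancel h).symm
      have h0' := conj_root_sub_root_ne_zero h1
      rw [root_sub, root_add]
      have e1 := root_mul_conj n j
      have e2 := root_mul_conj n i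
      have hj : conj (root n j) ≠ 0 := right_ne_zero_of_mul_eq_one e1
      have hi := root_ne_zero n i
      have key : conj (root n j - root n j * root n j * conj (root n i))
          = -(conj (root n j) * root n i) * conj (root n j - root n i) := by
        simp only [map_sub, map_mul, conj_conj]
        linear_combination (-conj (root n j)) * e2
      rw [key]
      have hX : conj (root n j) * root n i - 1 = root n i * conj (root n j - root n i) := by
        simp only [map_sub]
        linear_combination e2
      generalize conj (root n j - root n i) = X at *
      field_simp
      linear_combination hX - root n i * X * e1
    rw [Finset.sum_congr rfl this, Finset.sum_const, Finset.card_erase_of_mem (Finset.mem_univ _),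
      Finset.card_univ, Fintype.card_fin, nsmul_eq_mul, Nat.cast_sub (NeZero.one_le), Nat.cast_one]
  rw [Finset.sum_add_distrib,
    sum_erase_reflect (fun i => (conj (root n j - root n i))⁻¹) j] at h2
  linear_combination h2 / 2

/-- The same reflection changes the sign of every term. This makes the terms linear in the angles
disappear from the expansion at the ring. -/
theorem sum_im_div_re_root (i : Fin n) :
    ∑ j ∈ Finset.univ.erase i,
      (root n i * conj (root n j)).im / (1 - (root n i * conj (root n j)).re) = 0 := by
  have h := sum_erase_reflect (fun j => (root n i * conj (root n j)).im
    / (1 - (root n i * conj (root n j)).re)) i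
  have h2 : ∀ j : Fin n, root n i * conj (root n (i + i - j)) = conj (root n i * conj (root n j)) := by
    intro j
    rw [root_sub, root_add]
    simp only [map_mul, conj_conj]
    linear_combination (conj (root n i) * root n j) * root_mul_conj n i
  simp only [h2, conj_im, conj_re, neg_div, Finset.sum_neg_distrib] at h
  linarith

/-- The discrete Fourier transform. -/
noncomputable def fourier (g : Fin n → ℝ) (k : Fin n) : ℂ :=
  ∑ j, (g j : ℂ) * root n j ^ (k : ℕ)

theorem sum_root_pow (i j : Fin n) :
    ∑ k : Fin n, root n i ^ (k : ℕ) * conj (root n j) ^ (k : ℕ) = if i = j then (n : ℂ) else 0 := by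
  have h : ∀ k : Fin n, root n i ^ (k : ℕ) * conj (root n j) ^ (k : ℕ)
      = root n (i - j) ^ (k : ℕ) := fun k => by rw [root_sub, mul_pow]
  simp only [h]
  rw [Fin.sum_univ_eq_sum_range (fun k => root n (i - j) ^ k)]
  split_ifs with hij
  · subst hij
    simp [root_zero]
  · have h1 : root n (i - j) ≠ 1 := by
      rw [← root_zero (n := n)]
      exact fun h' => hij (sub_eq_zero.1 (root_injective h'))
    rw [geom_sum_eq h1, root_pow_card, sub_self, zero_div]

theorem parseval (g : Fin n → ℝ) : ∑ k, normSq (fourier g k) = n * ∑ j, g j ^ 2 := by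
  have h : ((∑ k, normSq (fourier g k) : ℝ) : ℂ) = ((n * ∑ j, g j ^ 2 : ℝ) : ℂ) := by
    push_cast
    have h1 : ∀ k : Fin n, ((normSq (fourier g k) : ℝ) : ℂ) = ∑ i, ∑ j, (g i : ℂ) * g j *
        (root n i ^ (k : ℕ) * conj (root n j) ^ (k : ℕ)) := by
      intro k
      rw [← mul_conj, fourier, map_sum, Finset.sum_mul_sum]
      refine Finset.sum_congr rfl fun i _ => Finset.sum_congr rfl fun j _ => ?_
      simp only [map_mul, map_pow, conj_ofReal]
      ring
    simp only [h1]
    rw [Finset.sum_comm, Finset.mul_sum]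
    refine Finset.sum_congr rfl fun i _ => ?_
    rw [Finset.sum_comm]
    simp_rw [← Finset.mul_sum, sum_root_pow]
    simp
    ring
  exact_mod_cast h

theorem fourier_shift_sub (g : Fin n → ℝ) (l k : Fin n) :
    fourier (fun j => g (j + l) - g j) k = (conj (root n l) ^ (k : ℕ) - 1) * fourier g k := by
  have h1 : ∑ j, (g (j + l) : ℂ) * root n j ^ (k : ℕ)
      = ∑ j, conj (root n l) ^ (k : ℕ) * ((g j : ℂ) * root n j ^ (k : ℕ)) := by
    rw [← Equiv.sum_comp (Equiv.addRight l) fun j => conj (root n l) ^ (k : ℕ) *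
      ((g j : ℂ) * root n j ^ (k : ℕ))]
    refine Finset.sum_congr rfl fun j _ => ?_
    simp only [Equiv.coe_addRight, root_add, mul_pow]
    have := congrArg (· ^ (k : ℕ)) (root_mul_conj n l)
    simp only [mul_pow, one_pow] at this
    linear_combination (-(g (j + l) : ℂ) * root n j ^ (k : ℕ)) * this
  simp only [fourier, ofReal_sub, sub_mul, Finset.sum_sub_distrib, h1, one_mul, Finset.mul_sum]

theorem sum_sq_shift_sub (g : Fin n → ℝ) (l : Fin n) :
    n * ∑ j, (g (j + l) - g j) ^ 2
      = ∑ k : Fin n, normSq (1 - root n l ^ (k : ℕ)) * normSq (fourier g k) := by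
  rw [← parseval]
  refine Finset.sum_congr rfl fun k _ => ?_
  rw [fourier_shift_sub, normSq_mul]
  congr 1
  rw [← normSq_conj, ← normSq_neg]
  congr 1
  simp

/-- The quotient `(1 - ζ ^ k) / (1 - ζ)` is a geometric sum, namely the Fourier transform of the
indicator function of `{0, …, k - 1}`. Parseval gives the total `n k`, from which the excluded
frequency `0` takes `k²`. -/
theorem sum_normSq_div (k : Fin n) :
    ∑ l ∈ Finset.univ.erase (0 : Fin n), normSq (1 - root n l ^ (k : ℕ)) / normSq (1 - root n l)
      = k * (n - k) := by
  set h : Fin n → ℝ := fun j => if j < k then 1 else 0 with hh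
  have hF : ∀ l, fourier h l = ∑ a ∈ Finset.range k, root n l ^ a := by
    intro l
    simp only [fourier, hh, root_pow_comm n _ l]
    have h1 : ∀ j : Fin n, ((if j < k then 1 else 0 : ℝ) : ℂ) * root n l ^ (j : ℕ)
        = (fun a : ℕ => if a < (k : ℕ) then root n l ^ a else 0) j := by
      intro j
      by_cases hj : j < k <;> simp [hj]
    rw [Finset.sum_congr rfl fun j _ => h1 j, Fin.sum_univ_eq_sum_range
      (fun a : ℕ => if a < (k : ℕ) then root n l ^ a else 0), ← Finset.sum_filter]
    congr 1
    ext a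
    simp only [Finset.mem_filter, Finset.mem_range]
    exact ⟨fun h => h.2, fun h => ⟨h.trans k.2, h⟩⟩
  have hp := parseval h
  have hs : ∑ j, h j ^ 2 = k := by
    have : Finset.univ.filter (fun j : Fin n => j < k) = Finset.Iio k := by ext; simp
    simp [hh, this]
  rw [hs, ← Finset.add_sum_erase _ _ (Finset.mem_univ (0 : Fin n))] at hp
  have h0 : normSq (fourier h 0) = (k : ℝ) ^ 2 := by
    rw [hF]
    simp [root_zero, sq]
  have h1 : ∀ l ∈ Finset.univ.erase (0 : Fin n), normSq (1 - root n l ^ (k : ℕ))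
      / normSq (1 - root n l) = normSq (fourier h l) := by
    intro l hl
    have hl1 : root n l ≠ 1 := by
      rw [← root_zero (n := n)]
      exact fun h' => Finset.ne_of_mem_erase hl (root_injective h')
    rw [hF, geom_sum_eq hl1, normSq_div, ← normSq_neg, neg_sub, ← normSq_neg (1 - root n l),
      neg_sub]
  rw [Finset.sum_congr rfl h1]
  linarith

/-- The quadratic form on the left is circulant, so the Fourier transform diagonalizes it, with
eigenvalues `k (n - k)` by `sum_normSq_div`. These are integers not exceeding `n² / 4`, hence not
exceeding its floor. -/
theorem sum_sq_sub_div_normSq_le (g : Fin n → ℝ) :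
    ∑ i, ∑ j ∈ Finset.univ.erase i, (g i - g j) ^ 2 / normSq (root n i - root n j)
      ≤ ⌊(n : ℝ) ^ 2 / 4⌋ * ∑ j, g j ^ 2 := by
  have hn : (0 : ℝ) < n := by exact_mod_cast NeZero.pos n
  have h1 : ∀ i : Fin n, ∑ j ∈ Finset.univ.erase i, (g i - g j) ^ 2 / normSq (root n i - root n j)
      = ∑ l ∈ Finset.univ.erase (0 : Fin n), (g (i + l) - g i) ^ 2 / normSq (1 - root n l) := by
    intro i
    refine Finset.sum_bij' (fun j _ => j - i) (fun l _ => i + l) ?_ ?_ ?_ ?_ ?_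
    · intro j hj
      simpa [sub_eq_zero] using hj
    · intro l hl
      simpa using hl
    · intro j _; simp
    · intro j _; simp
    · intro j _
      have : root n i - root n j = root n i * (1 - root n (j - i)) := by
        rw [root_sub]
        linear_combination root n j * root_mul_conj n i
      rw [add_sub_cancel, this, normSq_mul, normSq_root, one_mul]
      ring
  simp only [h1]
  rw [Finset.sum_comm]
  have h2 : ∀ l : Fin n, ∑ i, (g (i + l) - g i) ^ 2 / normSq (1 - root n l)
      = (1 / n) * ∑ k : Fin n, normSq (1 - root n l ^ (k : ℕ)) / normSq (1 - root n l) *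
        normSq (fourier g k) := by
    intro l
    rw [← Finset.sum_div, eq_comm, one_div, inv_mul_eq_iff_eq_mul₀ hn.ne', mul_div_assoc',
      sum_sq_shift_sub, Finset.sum_div]
    exact Finset.sum_congr rfl fun k _ => by ring
  simp only [h2]
  rw [← Finset.mul_sum, Finset.sum_comm]
  simp only [← Finset.sum_mul, sum_normSq_div]
  have h3 : ∀ k : Fin n, ((k : ℕ) : ℝ) * (n - (k : ℕ)) ≤ ⌊(n : ℝ) ^ 2 / 4⌋ := by
    intro k
    have : ((k : ℤ) * (n - k) : ℤ) ≤ ⌊(n : ℝ) ^ 2 / 4⌋ := by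
      rw [Int.le_floor]
      push_cast
      nlinarith [sq_nonneg ((n : ℝ) - 2 * (k : ℕ))]
    exact_mod_cast this
  calc 1 / (n : ℝ) * ∑ k : Fin n, ((k : ℕ) : ℝ) * (n - (k : ℕ)) * normSq (fourier g k)
      ≤ 1 / (n : ℝ) * ∑ k : Fin n, (⌊(n : ℝ) ^ 2 / 4⌋ : ℝ) * normSq (fourier g k) := by
        gcongr with k _
        · exact normSq_nonneg _
        · exact h3 k
    _ = _ := by
        rw [← Finset.mul_sum, parseval]
        field_simp

end VortexRing

/-! ### Global solutions of differential equations, and functions along them. -/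

namespace VortexRing

open Set Metric

section

variable {E : Type*} [NormedAddCommGroup E] [NormedSpace ℝ E] [CompleteSpace E]

/-- A bounded Lipschitz vector field is complete. -/
theorem exists_global_solution {Y : E → E} {K L : NNReal} (hK : LipschitzWith K Y)
    (hL : ∀ x, ‖Y x‖ ≤ L) (x : E) : ∃ γ : ℝ → E, γ 0 = x ∧ ∀ t, HasDerivAt γ (Y (γ t)) t := by
  have hloc : ∀ T : NNReal, ∃ α : ℝ → E, α 0 = x ∧
      ∀ t ∈ Ioo (-(T : ℝ)) T, HasDerivAt α (Y (α t)) t := by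
    intro T
    -- With speed at most `L`, a ball of radius `L * T` cannot be left before time `T`, so
    -- Picard–Lindelöf covers the whole interval at once.
    have hpl : IsPicardLindelof (fun _ => Y) (tmin := -(T : ℝ)) (tmax := T)
        ⟨0, by simp, by simp⟩ x (L * T) 0 L K :=
      IsPicardLindelof.of_time_independent (fun y _ => hL y) hK.lipschitzOnWith (by simp)
    obtain ⟨α, hα0, hα⟩ := hpl.exists_eq_forall_mem_Icc_hasDerivWithinAt₀
    exact ⟨α, hα0, fun t ht =>
      (hα t (Ioo_subset_Icc_self ht)).hasDerivAt (Icc_mem_nhds ht.1 ht.2)⟩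
  choose α hα0 hα using hloc
  have huniq : ∀ S T : NNReal, 0 < S → S ≤ T → EqOn (α S) (α T) (Ioo (-(S : ℝ)) S) := by
    intro S T hS hST
    have hST' : (S : ℝ) ≤ T := by exact_mod_cast hST
    have hS' : (0 : ℝ) < S := by exact_mod_cast hS
    exact ODE_solution_unique_of_mem_Ioo (v := fun _ => Y) (s := fun _ => univ) (t₀ := 0)
      (fun _ _ => hK.lipschitzOnWith) ⟨by linarith, hS'⟩ (fun t ht => ⟨hα S t ht, trivial⟩)
      (fun t ht => ⟨hα T t ⟨by linarith [ht.1], by linarith [ht.2]⟩, trivial⟩)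
      (by rw [hα0, hα0])
  -- Gluing: at time `t` the solution on the interval of half-length `|t| + 1` is evaluated. By
  -- uniqueness it agrees near `t` with the single solution on the interval of half-length `|t| +
  -- 2`.
  refine ⟨fun t => α (‖t‖₊ + 1) t, hα0 _, fun t => ?_⟩
  have ht : t ∈ Ioo (-((‖t‖₊ + 2 : NNReal) : ℝ)) ((‖t‖₊ + 2 : NNReal) : ℝ) := by
    push_cast
    rw [Real.norm_eq_abs]
    constructor <;> linarith [le_abs_self t, neg_abs_le t]
  have hev : (fun s => α (‖s‖₊ + 1) s) =ᶠ[𝓝 t] α (‖t‖₊ + 2) := by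
    have : ∀ᶠ s in 𝓝 t, ‖s‖₊ < ‖t‖₊ + 1 :=
      (continuous_nnnorm.tendsto t).eventually (gt_mem_nhds (by simp))
    filter_upwards [this] with s hs
    refine huniq _ _ (by positivity) ?_ ?_
    · have := add_le_add_left hs.le 1
      calc ‖s‖₊ + 1 ≤ ‖t‖₊ + 1 + 1 := this
        _ = ‖t‖₊ + 2 := by ring
    · push_cast
      rw [Real.norm_eq_abs]
      constructor <;> linarith [le_abs_self s, neg_abs_le s]
  have hYt : Y ((fun s => α (‖s‖₊ + 1) s) t) = Y (α (‖t‖₊ + 2) t) := congrArg Y hev.eq_of_nhds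
  rw [hYt]
  exact (hα _ t ht).congr_of_eventuallyEq hev

end

/-- After a cut-off, the solution of a differential equation that starts in a compact set exists for
all time. -/
theorem exists_cutoff_solution {E : Type*} [NormedAddCommGroup E] [NormedSpace ℝ E]
    [FiniteDimensional ℝ E] {X : E → E} {O K : Set E} (hO : IsOpen O) (hK : IsCompact K)
    (hKO : K ⊆ O) (hX : ContDiffOn ℝ 1 X O) {x : E} (hx : x ∈ K) :
    ∃ (γ : ℝ → E) (c : ℝ → ℝ), γ 0 = x ∧ (∀ t, HasDerivAt γ (c t • X (γ t)) t) ∧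
      (∀ t, γ t ∈ K → c t = 1) ∧ ∀ t, γ t ∈ O := by
  have : CompleteSpace E := FiniteDimensional.complete ℝ E
  obtain ⟨δ, hδ, hδO⟩ := hK.exists_cthickening_subset_open hO hKO
  have hcomp : IsCompact (cthickening δ K) := hK.cthickening
  obtain ⟨f, hf1, hf0, -⟩ := exists_contMDiffMap_one_nhds_of_subset_interior (n := 1)
    (modelWithCornersSelf ℝ E) hK.isClosed
    ((self_subset_thickening hδ K).trans (interior_maximal (thickening_subset_cthickening δ K)
      isOpen_thickening))
  have hfs : ContDiff ℝ 1 (f : E → ℝ) := f.contMDiff.contDiff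
  -- The cut-off field is `C¹` with compact support, hence bounded and Lipschitz.
  set Y : E → E := fun y => f y • X y with hY
  have hsupp : tsupport (f : E → ℝ) ⊆ cthickening δ K :=
    closure_minimal (fun y hy => by_contra fun h => hy (hf0 y h)) isClosed_cthickening
  have hYsupp : HasCompactSupport Y :=
    HasCompactSupport.intro hcomp fun y hy => by simp [hY, hf0 y hy]
  have hYs : ContDiff ℝ 1 Y := by
    rw [contDiff_iff_contDiffAt]
    intro y
    by_cases hy : y ∈ tsupport (f : E → ℝ)
    · exact hfs.contDiffAt.smul (hX.contDiffAt (hO.mem_nhds (hδO (hsupp hy))))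
    · have : Y =ᶠ[𝓝 y] fun _ => 0 := by
        filter_upwards [(isClosed_tsupport _).isOpen_compl.mem_nhds hy] with z hz
        simp [hY, image_eq_zero_of_notMem_tsupport hz]
      exact contDiffAt_const.congr_of_eventuallyEq this
  obtain ⟨C, hC⟩ := hYs.lipschitzWith_of_hasCompactSupport hYsupp one_ne_zero
  obtain ⟨L, hL⟩ := hYsupp.exists_bound_of_continuous hYs.continuous
  obtain ⟨γ, hγ0, hγ⟩ := exists_global_solution hC (L := L.toNNReal)
    (fun y => (hL y).trans (Real.le_coe_toNNReal L)) x
  refine ⟨γ, fun t => f (γ t), hγ0, hγ, fun t ht => hf1.self_of_nhdsSet _ ht, fun t => ?_⟩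
  -- Outside `O` the cut-off field vanishes. A solution that reached such a point would be constant
  -- by uniqueness, although it starts in `K ⊆ O`.
  by_contra hcon
  have hYt : Y (γ t) = 0 := by simp [hY, hf0 _ fun h => hcon (hδO h)]
  have hconst : γ = fun _ => γ t :=
    ODE_solution_unique_univ (v := fun _ => Y) (s := fun _ => univ) (t₀ := t)
      (fun _ => hC.lipschitzOnWith) (fun s => ⟨hγ s, trivial⟩)
      (fun s => ⟨by simpa [hYt] using hasDerivAt_const s (γ t), trivial⟩) rfl
  exact hcon (by rw [← congrFun hconst 0, hγ0]; exact hKO hx)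

/-- A continuous function on an interval that starts below a level and does not attain it stays
below it. -/
theorem lt_of_forall_ne {I : Set ℝ} (hI : I.OrdConnected) {d : ℝ → ℝ} (hd : ContinuousOn d I)
    {ε : ℝ} {a : ℝ} (ha : a ∈ I) (h0 : d a < ε) (hne : ∀ t ∈ I, d t ≠ ε) : ∀ t ∈ I, d t < ε := by
  intro t ht
  by_contra hcon
  obtain ⟨s, hs, hs'⟩ := hI.isPreconnected.intermediate_value ha ht hd ⟨h0.le, not_lt.1 hcon⟩
  exact hne s hs hs'

/-- A function with vanishing derivative on an open interval is constant there. -/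
theorem eq_of_hasDerivAt_zero {I : Set ℝ} (hIo : IsOpen I) (hI : I.OrdConnected) {f : ℝ → ℝ}
    (hf : ∀ t ∈ I, HasDerivAt f 0 t) {a t : ℝ} (ha : a ∈ I) (ht : t ∈ I) : f t = f a :=
  hIo.is_const_of_deriv_eq_zero hI.isPreconnected
    (fun s hs => (hf s hs).differentiableAt.differentiableWithinAt)
    (fun s hs => (hf s hs).deriv) ht ha

end VortexRing

/-! ### Second-order lower bounds in logarithmic polar coordinates. -/

namespace VortexRing

open Filter

/-- A function lies above its osculating parabola, if the latter is made a bit less curved. -/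
theorem eventually_parabola_le {f f' : ℝ → ℝ} {c m : ℝ} (hf : ∀ᶠ x in 𝓝 0, HasDerivAt f (f' x) x)
    (hf' : HasDerivAt f' c 0) (hm : m < c) :
    ∀ᶠ x in 𝓝 0, f 0 + f' 0 * x + m / 2 * x ^ 2 ≤ f x := by
  set k : ℝ → ℝ := fun x => f x - f' 0 * x - m / 2 * x ^ 2 with hk
  have hk' : ∀ᶠ x in 𝓝 0, HasDerivAt k (f' x - f' 0 - m * x) x := by
    filter_upwards [hf] with x hx
    have h := (hx.sub ((hasDerivAt_id x).const_mul (f' 0))).sub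
      (((hasDerivAt_id x).pow 2).const_mul (m / 2))
    refine h.congr_deriv ?_
    simp; ring
  have hd : deriv k =ᶠ[𝓝 0] fun x => f' x - f' 0 - m * x := hk'.mono fun x hx => hx.deriv
  have hdd : HasDerivAt (fun x => f' x - f' 0 - m * x) (c - m) 0 := by
    have h := (hf'.sub_const (f' 0)).sub ((hasDerivAt_id (0 : ℝ)).const_mul m)
    exact h.congr_deriv (by simp)
  -- At `0` the difference `k` has slope `0` and second derivative `c - m > 0`.
  have hmin : IsLocalMin k 0 := by
    refine isLocalMin_of_deriv_deriv_pos ?_ ?_ hk'.self_of_nhds.continuousAt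
    · rw [hd.deriv_eq, hdd.deriv]
      linarith
    · rw [hd.eq_of_nhds]
      simp
  filter_upwards [hmin] with x hx
  simp only [hk] at hx
  simp at hx
  linarith

theorem eventually_cosh_le {K : ℝ} (hK : 1 < K) :
    ∀ᶠ s in 𝓝 (0 : ℝ), Real.cosh s - 1 ≤ K / 2 * s ^ 2 := by
  have h := eventually_parabola_le (f := fun s => -Real.cosh s) (f' := fun s => -Real.sinh s)
    (c := -1) (m := -K) (Eventually.of_forall fun x => (Real.hasDerivAt_cosh x).neg)
    ((Real.hasDerivAt_sinh 0).neg.congr_deriv (by simp)) (by linarith)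
  filter_upwards [h] with s hs
  simp at hs
  linarith

/-- The second derivative at `t = 0` is `1 / (1 - cos α)`, which is at least `1 / 2`. The bound uses
`1 / 4`, so the coefficient `1 / 8` serves all angles `α` alike. -/
theorem eventually_angle_le {α : ℝ} (hα : Real.cos α < 1) :
    ∀ᶠ t in 𝓝 (0 : ℝ), -Real.log (1 - Real.cos α) - Real.sin α / (1 - Real.cos α) * t + t ^ 2 / 8
      ≤ -Real.log (1 - Real.cos (α + t)) := by
  have hpos : ∀ᶠ t in 𝓝 (0 : ℝ), 1 - Real.cos (α + t) ≠ 0 := by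
    have hc : ContinuousAt (fun t => 1 - Real.cos (α + t)) 0 := by fun_prop
    exact hc.eventually_ne (by simp; linarith)
  have hcos : ∀ t, HasDerivAt (fun t => 1 - Real.cos (α + t)) (Real.sin (α + t)) t := by
    intro t
    have h := ((Real.hasDerivAt_cos (α + t)).comp t ((hasDerivAt_id t).const_add α)).const_sub 1
    exact h.congr_deriv (by simp)
  have hsin : HasDerivAt (fun t => Real.sin (α + t)) (Real.cos (α + 0)) 0 := by
    have h := (Real.hasDerivAt_sin (α + 0)).comp 0 ((hasDerivAt_id (0 : ℝ)).const_add α)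
    exact h.congr_deriv (by simp)
  have h0 : 0 < 1 - Real.cos α := by linarith
  have h := eventually_parabola_le (f := fun t => -Real.log (1 - Real.cos (α + t)))
    (f' := fun t => -(Real.sin (α + t) / (1 - Real.cos (α + t)))) (c := 1 / (1 - Real.cos α))
    (m := 1 / 4) (hpos.mono fun t ht => ((hcos t).log ht).neg) ?_ ?_
  · filter_upwards [h] with t ht
    simp only [add_zero] at ht
    linarith
  · refine ((hsin.div (hcos 0) hpos.self_of_nhds).neg).congr_deriv ?_
    simp only [add_zero]
    field_simp
    nlinarith [Real.sin_sq_add_cos_sq α]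
  · rw [lt_div_iff₀ h0]
    linarith [Real.neg_one_le_cos α]

/-- With `D = 1 - cos (α + t)` the argument of the logarithm is `D * (1 + (cosh s - 1) / D)`, and
`log (1 + q) ≤ q` separates the radial from the angular part without mixed terms. The slack `K > 1`
pays for the higher-order terms of `cosh` and for the variation of `D`. -/
theorem eventually_pair_le {α K : ℝ} (hα : Real.cos α < 1) (hK : 1 < K) :
    ∀ᶠ y in 𝓝 (0 : ℝ × ℝ), -Real.log (1 - Real.cos α)
      - Real.sin α / (1 - Real.cos α) * y.2 + y.2 ^ 2 / 8
      - K / 2 * (y.1 ^ 2 / (1 - Real.cos α)) ≤ -Real.log (Real.cosh y.1 - Real.cos (α + y.2)) := by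
  have h0 : 0 < 1 - Real.cos α := by linarith
  have hfst : Tendsto Prod.fst (𝓝 (0 : ℝ × ℝ)) (𝓝 0) := continuous_fst.tendsto _
  have hsnd : Tendsto Prod.snd (𝓝 (0 : ℝ × ℝ)) (𝓝 0) := continuous_snd.tendsto _
  -- The slack is shared: `cosh s - 1` costs a factor `(1 + K) / 2` and the denominator a factor `(1
  -- + K) / (2 K)`; their quotient is `K`.
  have hden : ∀ᶠ t in 𝓝 (0 : ℝ), (1 + K) / (2 * K) * (1 - Real.cos α) < 1 - Real.cos (α + t) := by
    have hc : ContinuousAt (fun t => 1 - Real.cos (α + t)) 0 := by fun_prop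
    refine hc.eventually (lt_mem_nhds ?_)
    simp only [add_zero]
    have : (1 + K) / (2 * K) < 1 := by rw [div_lt_one (by linarith)]; linarith
    nlinarith
  filter_upwards [hfst.eventually (eventually_cosh_le (K := (1 + K) / 2) (by linarith)),
    hsnd.eventually (eventually_angle_le hα), hsnd.eventually hden] with y h1 h2 h3
  have hK' : 0 < (1 + K) / (2 * K) := by positivity
  set D := 1 - Real.cos (α + y.2) with hD
  set A := 1 - Real.cos α with hA
  have hDpos : 0 < D := (mul_pos hK' h0).trans h3
  have hC : 0 ≤ Real.cosh y.1 - 1 := by linarith [Real.one_le_cosh y.1]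
  have hCD : (Real.cosh y.1 - 1) / D ≤ K / 2 * (y.1 ^ 2 / A) := by
    rw [div_le_iff₀ hDpos]
    refine h1.trans ?_
    calc (1 + K) / 2 / 2 * y.1 ^ 2 = K / 2 * (y.1 ^ 2 / A) * ((1 + K) / (2 * K) * A) := by
          field_simp
      _ ≤ K / 2 * (y.1 ^ 2 / A) * D := by gcongr
  have hsplit : Real.cosh y.1 - Real.cos (α + y.2) = D * (1 + (Real.cosh y.1 - 1) / D) := by
    field_simp
    rw [hD]; ring
  have hq : 0 ≤ (Real.cosh y.1 - 1) / D := div_nonneg hC hDpos.le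
  rw [hsplit, Real.log_mul hDpos.ne' (by linarith)]
  have := Real.log_le_sub_one_of_pos (x := 1 + (Real.cosh y.1 - 1) / D) (by linarith)
  linarith

/-- The part of the Lyapunov function that depends on the radial coordinate of a single vortex. -/
noncomputable def radial (N x s : ℝ) : ℝ :=
  -N * (s - Real.log (1 + x * Real.exp (2 * s)))
    + N * (1 - x ^ 2) / 2 * (Real.exp (2 * s) / (1 + x * Real.exp (2 * s)))

/-- The factor `N (1 - x²) / 2` in `radial` is chosen so that the slope at `s = 0` vanishes. The
second derivative there is `N (4 x + 2 (1 - x)²) / (1 + x)²`, which is the bound on `m`. -/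
theorem eventually_radial_le {N x m : ℝ} (hx : 0 < 1 + x)
    (hm : m < 2 * N * ((1 + x ^ 2) / (1 + x) ^ 2)) :
    ∀ᶠ s in 𝓝 (0 : ℝ), radial N x 0 + m / 2 * s ^ 2 ≤ radial N x s := by
  have hpos : ∀ᶠ s in 𝓝 (0 : ℝ), 1 + x * Real.exp (2 * s) ≠ 0 := by
    have hc : ContinuousAt (fun s => 1 + x * Real.exp (2 * s)) 0 := by fun_prop
    exact hc.eventually_ne (by simp; linarith)
  have hE : ∀ s, HasDerivAt (fun s => Real.exp (2 * s)) (2 * Real.exp (2 * s)) s := by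
    intro s
    have h := ((hasDerivAt_id s).const_mul 2).exp
    exact h.congr_deriv (by simp; ring)
  have hS : ∀ s, HasDerivAt (fun s => 1 + x * Real.exp (2 * s)) (x * (2 * Real.exp (2 * s))) s :=
    fun s => ((hE s).const_mul x).const_add 1
  have h := eventually_parabola_le (f := radial N x) (f' := fun s =>
      -N * (1 - x * (2 * Real.exp (2 * s)) / (1 + x * Real.exp (2 * s)))
      + N * (1 - x ^ 2) / 2 * (2 * Real.exp (2 * s) / (1 + x * Real.exp (2 * s)) ^ 2))
    (c := 2 * N * ((1 + x ^ 2) / (1 + x) ^ 2)) (m := m) ?_ ?_ hm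
  · filter_upwards [h] with s hs
    have h0 : -N * (1 - x * (2 * Real.exp (2 * 0)) / (1 + x * Real.exp (2 * 0)))
      + N * (1 - x ^ 2) / 2 * (2 * Real.exp (2 * 0) / (1 + x * Real.exp (2 * 0)) ^ 2) = 0 := by
      simp only [mul_zero, Real.exp_zero, mul_one]
      field_simp
      ring
    rw [h0] at hs
    linarith
  · filter_upwards [hpos] with s hs
    have h1 := (((hasDerivAt_id s).sub ((hS s).log hs)).const_mul (-N)).add
      (((hE s).div (hS s) hs).const_mul (N * (1 - x ^ 2) / 2))
    refine h1.congr_deriv ?_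
    congr 2
    congr 1
    ring
  · have h1 := ((((hE 0).const_mul 2).const_mul x).div (hS 0) hpos.self_of_nhds).const_sub 1
    have h2 := ((hE 0).const_mul 2).div ((hS 0).pow 2) (pow_ne_zero 2 hpos.self_of_nhds)
    have h3 := (h1.const_mul (-N)).add (h2.const_mul (N * (1 - x ^ 2) / 2))
    refine h3.congr_deriv ?_
    simp only [mul_zero, Real.exp_zero, mul_one, Pi.pow_apply]
    have : 1 + x ≠ 0 := hx.ne'
    field_simp
    ring

/-- The argument of the `j`-th vertex of the regular `n`-gon. -/
noncomputable def angle (n : ℕ) (j : Fin n) : ℝ := 2 * Real.pi * (j : ℕ) / n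

theorem root_mul_conj_eq_exp (n : ℕ) (i j : Fin n) :
    root n i * (starRingEnd ℂ) (root n j) = Complex.exp (((angle n i - angle n j : ℝ) : ℂ) * Complex.I) := by
  rw [root_eq_exp_angle, root_eq_exp_angle, ← Complex.exp_conj, ← Complex.exp_add]
  congr 1
  simp only [angle, map_mul, Complex.conj_ofReal, Complex.conj_I]
  push_cast
  ring

theorem cos_angle_sub (n : ℕ) (i j : Fin n) :
    Real.cos (angle n i - angle n j) = (root n i * (starRingEnd ℂ) (root n j)).re := by
  rw [root_mul_conj_eq_exp, Complex.exp_ofReal_mul_I_re]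

theorem sin_angle_sub (n : ℕ) (i j : Fin n) :
    Real.sin (angle n i - angle n j) = (root n i * (starRingEnd ℂ) (root n j)).im := by
  rw [root_mul_conj_eq_exp, Complex.exp_ofReal_mul_I_im]

theorem normSq_root_sub (n : ℕ) (i j : Fin n) :
    Complex.normSq (root n i - root n j) = 2 * (1 - Real.cos (angle n i - angle n j)) := by
  rw [Complex.normSq_sub, normSq_root, normSq_root, cos_angle_sub]
  ring

theorem cos_angle_sub_lt {n : ℕ} [NeZero n] {i j : Fin n} (h : i ≠ j) :
    Real.cos (angle n i - angle n j) < 1 := by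
  have h1 := Complex.normSq_pos.2 (sub_ne_zero.2 fun h' => h (root_injective h'))
  rw [normSq_root_sub] at h1
  linarith

/-- The Lyapunov function, up to a constant, in logarithmic polar coordinates relative to the regular
ring. -/
noncomputable def polarLyapunov (n : ℕ) (x : ℝ) (s t : Fin n → ℝ) : ℝ :=
  -(∑ i, ∑ j ∈ Finset.Ioi i,
      Real.log (Real.cosh (s i - s j) - Real.cos (angle n i - angle n j + (t i - t j))))
    + ∑ j, radial ((n : ℝ) - 1) x (s j)

/-- Sum of the pair and the radial estimates. The pairs lose at most `K M / 2` times `∑ s_j²`, the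
single-vortex terms gain almost `B / 2` times it, and the hypothesis is `M < B`. The angular squares
survive, so only a common rotation remains undetected. -/
theorem eventually_polarLyapunov_le {n : ℕ} [NeZero n] {x : ℝ} (hx : 0 < 1 + x)
    (h : (⌊(n : ℝ) ^ 2 / 4⌋ : ℝ) < 2 * ((n : ℝ) - 1) * ((1 + x ^ 2) / (1 + x) ^ 2)) :
    ∃ c > 0, ∀ᶠ y in 𝓝 (0 : (Fin n → ℝ) × (Fin n → ℝ)),
      polarLyapunov n x 0 0 + c * ∑ j, y.1 j ^ 2
        + ∑ i, ∑ j ∈ Finset.Ioi i, (y.2 i - y.2 j) ^ 2 / 8 ≤ polarLyapunov n x y.1 y.2 := by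
  set M : ℝ := (⌊(n : ℝ) ^ 2 / 4⌋ : ℝ) with hM
  set B : ℝ := 2 * ((n : ℝ) - 1) * ((1 + x ^ 2) / (1 + x) ^ 2) with hB
  have hM0 : 0 ≤ M := by
    rw [hM]
    exact_mod_cast Int.floor_nonneg.2 (by positivity : (0 : ℝ) ≤ (n : ℝ) ^ 2 / 4)
  obtain ⟨K, hK1, hKB⟩ : ∃ K : ℝ, 1 < K ∧ M * K < B := by
    -- The denominator `M + 1` avoids division by zero, and `M * K` stays below the midpoint of `M`
    -- and `B`.
    refine ⟨1 + (B - M) / (2 * (M + 1)), ?_, ?_⟩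
    · have : 0 < (B - M) / (2 * (M + 1)) := div_pos (by linarith) (by linarith)
      linarith
    · have h1 : M * ((B - M) / (2 * (M + 1))) ≤ (B - M) / 2 := by
        rw [mul_div_assoc', div_le_div_iff₀ (by linarith) (by norm_num)]
        nlinarith
      linarith
  -- The radial estimate is used with curvature `(M K + B) / 2`, so `(M K + B) / 4 - M K / 2` is
  -- left.
  refine ⟨(B - M * K) / 4, by linarith, ?_⟩
  have hpair : ∀ᶠ y in 𝓝 (0 : (Fin n → ℝ) × (Fin n → ℝ)), ∀ i, ∀ j ∈ Finset.Ioi i,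
      -Real.log (1 - Real.cos (angle n i - angle n j))
      - Real.sin (angle n i - angle n j) / (1 - Real.cos (angle n i - angle n j))
        * (y.2 i - y.2 j) + (y.2 i - y.2 j) ^ 2 / 8
      - K / 2 * ((y.1 i - y.1 j) ^ 2 / (1 - Real.cos (angle n i - angle n j)))
      ≤ -Real.log (Real.cosh (y.1 i - y.1 j)
        - Real.cos (angle n i - angle n j + (y.2 i - y.2 j))) := by
    rw [eventually_all]
    intro i
    rw [Filter.eventually_all_finset]
    intro j hj
    have ht : Tendsto (fun y : (Fin n → ℝ) × (Fin n → ℝ) => (y.1 i - y.1 j, y.2 i - y.2 j)) (𝓝 0)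
        (𝓝 (0 : ℝ × ℝ)) := by
      have hc : Continuous fun y : (Fin n → ℝ) × (Fin n → ℝ) =>
        (y.1 i - y.1 j, y.2 i - y.2 j) := by fun_prop
      have := hc.tendsto 0
      simp only [Prod.fst_zero, Prod.snd_zero, Pi.zero_apply, sub_zero] at this
      exact this
    exact ht.eventually (eventually_pair_le (cos_angle_sub_lt (Finset.mem_Ioi.1 hj).ne) hK1)
  have hrad : ∀ᶠ y in 𝓝 (0 : (Fin n → ℝ) × (Fin n → ℝ)), ∀ j,
      radial ((n : ℝ) - 1) x 0 + (M * K + B) / 2 / 2 * y.1 j ^ 2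
        ≤ radial ((n : ℝ) - 1) x (y.1 j) := by
    rw [eventually_all]
    intro j
    have ht : Tendsto (fun y : (Fin n → ℝ) × (Fin n → ℝ) => y.1 j) (𝓝 0) (𝓝 0) := by
      have hc : Continuous fun y : (Fin n → ℝ) × (Fin n → ℝ) => y.1 j := by fun_prop
      simpa using hc.tendsto 0
    exact ht.eventually (eventually_radial_le hx (by linarith))
  filter_upwards [hpair, hrad] with y h1 h2
  have h1' := Finset.sum_le_sum fun i (_ : i ∈ Finset.univ) => Finset.sum_le_sum (h1 i)
  have h2' := Finset.sum_le_sum fun j (_ : j ∈ Finset.univ) => h2 j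
  simp only [Finset.sum_sub_distrib, Finset.sum_add_distrib, ← Finset.mul_sum,
    Finset.sum_neg_distrib] at h1' h2'
  -- The coefficients are antisymmetric, so the sum over pairs becomes a sum over ordered pairs, in
  -- which the coefficient of each `y.2 i` vanishes by `sum_im_div_re_root`.
  have hlin : ∑ i, ∑ j ∈ Finset.Ioi i,
      Real.sin (angle n i - angle n j) / (1 - Real.cos (angle n i - angle n j))
        * (y.2 i - y.2 j) = 0 := by
    have e : ∀ i j : Fin n, Real.sin (angle n i - angle n j)
        / (1 - Real.cos (angle n i - angle n j)) * (y.2 i - y.2 j)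
        = Real.sin (angle n i - angle n j) / (1 - Real.cos (angle n i - angle n j)) * y.2 i
          + Real.sin (angle n j - angle n i) / (1 - Real.cos (angle n j - angle n i)) * y.2 j := by
      intro i j
      rw [← neg_sub (angle n i) (angle n j), Real.sin_neg, Real.cos_neg]
      ring
    simp only [e]
    rw [sum_Ioi_add_eq fun i j => Real.sin (angle n i - angle n j)
      / (1 - Real.cos (angle n i - angle n j)) * y.2 i]
    simp_rw [← Finset.sum_mul, cos_angle_sub, sin_angle_sub, sum_im_div_re_root, zero_mul,
      Finset.sum_const_zero]
  have hquad : ∑ i, ∑ j ∈ Finset.Ioi i,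
      (y.1 i - y.1 j) ^ 2 / (1 - Real.cos (angle n i - angle n j)) ≤ M * ∑ j, y.1 j ^ 2 := by
    refine le_trans (le_of_eq ?_) (sum_sq_sub_div_normSq_le y.1)
    rw [← sum_Ioi_add_eq]
    refine Finset.sum_congr rfl fun i _ => Finset.sum_congr rfl fun j hj => ?_
    have := cos_angle_sub_lt (Finset.mem_Ioi.1 hj).ne
    rw [normSq_root_sub, normSq_root_sub, ← neg_sub (angle n i) (angle n j), Real.cos_neg]
    have h0 : 1 - Real.cos (angle n i - angle n j) ≠ 0 := by linarith
    field_simp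
    ring
  rw [hlin] at h1'
  have hquad' := mul_le_mul_of_nonneg_left hquad (by linarith : 0 ≤ K / 2)
  simp only [polarLyapunov, Pi.zero_apply, sub_zero, Real.cosh_zero, add_zero]
  linarith

end VortexRing

/-! ### The ring as a relative equilibrium; the Lyapunov function in polar coordinates. -/

namespace VortexRing

open Filter

/-- The regular ring, in the stereographic coordinate. -/
noncomputable def regularRing (lam r : ℝ) (n : ℕ) (j : Fin n) : Amb := stereo lam (r * root n j)

/-- The rotation of a configuration about the `u`-axis. -/
noncomputable def rotate {n : ℕ} (c : ℂ) (p : Fin n → Amb) (j : Fin n) : Amb :=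
  (c * (p j).1, (p j).2)

theorem rotating_eq_rotate {n : ℕ} (ω : ℝ) (p : Fin n → Amb) (t : ℝ) :
    rotating ω p t = rotate (Complex.exp (Complex.I * (ω * t : ℝ))) p := rfl

theorem normSq_mul_root (r : ℝ) (n : ℕ) (j : Fin n) :
    Complex.normSq (r * root n j) = r ^ 2 := by
  rw [Complex.normSq_mul, normSq_root, Complex.normSq_ofReal]; ring

theorem regularRing_apply (lam r : ℝ) (n : ℕ) (j : Fin n) :
    regularRing lam r n j = (((r / (1 + lam * r ^ 2) : ℝ) : ℂ) * root n j, r ^ 2 / (1 + lam * r ^ 2)) := by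
  rw [regularRing, stereo, normSq_mul_root]
  refine Prod.ext ?_ rfl
  push_cast
  ring

section Equilibrium

variable {n : ℕ} [NeZero n] {lam κ r : ℝ}

theorem rotate_ring_mem_phaseSpace (hr : 0 < r) (hx : 0 < 1 + lam * r ^ 2) {c : ℂ}
    (hc : Complex.normSq c = 1) : rotate c (regularRing lam r n) ∈ phaseSpace lam n := by
  have hR : (r / (1 + lam * r ^ 2) : ℝ) ≠ 0 := (div_pos hr hx).ne'
  refine ⟨fun j => ?_, fun i j hij => ?_⟩
  · have h := stereo_mem_surface (lam := lam) (z := r * root n j) (by rwa [normSq_mul_root])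
    change casimir lam (regularRing lam r n j) = 0 ∧ (lam < 0 → 0 ≤ (regularRing lam r n j).2) at h
    refine ⟨?_, h.2⟩
    rw [← h.1]
    simp [casimir, rotate, hc]
  · have h := congrArg Prod.fst hij
    simp only [rotate, regularRing_apply] at h
    have hc0 : c ≠ 0 := fun h0 => by simp [h0] at hc
    exact root_injective (mul_left_cancel₀ (Complex.ofReal_ne_zero.2 hR) (mul_left_cancel₀ hc0 h))

/-- The angular velocity of the ring. -/
noncomputable def ringVelocity (lam κ r : ℝ) (n : ℕ) : ℝ :=
  κ / (4 * Real.pi) * (((n : ℝ) - 1) * (1 - 2 * lam * (r ^ 2 / (1 + lam * r ^ 2)))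
    / (2 * (r / (1 + lam * r ^ 2)) ^ 2))

/-- All vertices have the same height, so the chords are horizontal and each term is the real part
of an inverse difference of roots of unity. By `sum_inv_conj_root_sub` they sum to a radial vector,
and tangency converts the radial component of `w` into its height. Thus `dH` is proportional to `d(∑
u_j)` at the ring. -/
theorem sum_bilin_div_quadForm_ring (hr : 0 < r) (hx : 0 < 1 + lam * r ^ 2) {c : ℂ}
    (hc : Complex.normSq c = 1) (j : Fin n) {w : Amb}
    (hw : IsTangent lam (rotate c (regularRing lam r n) j) w) :
    ∑ i ∈ Finset.univ.erase j,
      2 * bilin lam (rotate c (regularRing lam r n) j - rotate c (regularRing lam r n) i) w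
        / quadForm lam (rotate c (regularRing lam r n) j - rotate c (regularRing lam r n) i)
      = ((n : ℝ) - 1) * (1 - 2 * lam * (r ^ 2 / (1 + lam * r ^ 2)))
        / (2 * (r / (1 + lam * r ^ 2)) ^ 2) * w.2 := by
  simp only [rotate, regularRing_apply, IsTangent] at hw ⊢
  have hR : (r / (1 + lam * r ^ 2) : ℝ) ≠ 0 := (div_pos hr hx).ne'
  set R := r / (1 + lam * r ^ 2) with hRdef
  set u := r ^ 2 / (1 + lam * r ^ 2) with hu
  have hterm : ∀ i ∈ Finset.univ.erase j,
      2 * bilin lam ((c * ((R : ℂ) * root n j), u) - (c * ((R : ℂ) * root n i), u)) w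
        / quadForm lam ((c * ((R : ℂ) * root n j), u) - (c * ((R : ℂ) * root n i), u))
      = 2 / R * ((starRingEnd ℂ) c * w.1
          * (starRingEnd ℂ) ((starRingEnd ℂ) (root n j - root n i))⁻¹).re := by
    intro i hi
    have hij : root n j - root n i ≠ 0 :=
      sub_ne_zero.2 fun h => Finset.ne_of_mem_erase hi (root_injective h).symm
    have hq : quadForm lam ((c * ((R : ℂ) * root n j), u) - (c * ((R : ℂ) * root n i), u))
        = R ^ 2 * Complex.normSq (root n j - root n i) := by
      have : c * ((R : ℂ) * root n j) - c * ((R : ℂ) * root n i)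
          = c * (R * (root n j - root n i)) := by ring
      simp only [quadForm, Prod.fst_sub, Prod.snd_sub, this, Complex.normSq_mul, hc,
        Complex.normSq_ofReal]
      ring
    have hb : bilin lam ((c * ((R : ℂ) * root n j), u) - (c * ((R : ℂ) * root n i), u)) w
        = R * ((starRingEnd ℂ) c * w.1 * (starRingEnd ℂ) (root n j - root n i)).re := by
      simp [bilin]
      ring
    rw [hq, hb, map_inv₀, Complex.conj_conj, Complex.inv_def]
    have h0 : Complex.normSq (root n j - root n i) ≠ 0 := (Complex.normSq_pos.2 hij).ne'
    rw [← mul_assoc ((starRingEnd ℂ) c * w.1), Complex.re_mul_ofReal]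
    field_simp
  rw [Finset.sum_congr rfl hterm, ← Finset.mul_sum, ← Complex.re_sum, ← Finset.mul_sum, ← map_sum,
    sum_inv_conj_root_sub]
  have hn : ((n : ℂ) - 1) / 2 = ((((n : ℝ) - 1) / 2 : ℝ) : ℂ) := by push_cast; rfl
  rw [hn, map_mul, Complex.conj_ofReal]
  simp only [Complex.mul_re, Complex.mul_im, Complex.ofReal_re, Complex.ofReal_im, Complex.conj_re,
    Complex.conj_im] at hw ⊢
  field_simp
  linear_combination ((n : ℝ) - 1) * hw

theorem isTrajectory_rotating_ring (hr : 0 < r) (hx : 0 < 1 + lam * r ^ 2) :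
    IsTrajectory lam (fun _ : Fin n => κ) Set.univ
      (rotating (ringVelocity lam κ r n) (regularRing lam r n)) := by
  intro t _
  set ω := ringVelocity lam κ r n with hω
  rw [rotating_eq_rotate]
  set c := Complex.exp (Complex.I * (ω * t : ℝ)) with hc
  have hc1 : Complex.normSq c = 1 := by
    rw [Complex.normSq_eq_norm_sq, hc, mul_comm, Complex.norm_exp_ofReal_mul_I, one_pow]
  have hmem := rotate_ring_mem_phaseSpace (n := n) hr hx hc1
  refine ⟨hmem, fun j => (Complex.I * ω * (rotate c (regularRing lam r n) j).1, 0), ?_, fun w hw => ?_⟩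
  · rw [hasDerivAt_pi]
    intro j
    have h1 : HasDerivAt (fun t : ℝ => ω * t) ω t := by
      simpa using (hasDerivAt_id t).const_mul ω
    have h2 := ((h1.ofReal_comp.const_mul Complex.I).cexp.mul_const (regularRing lam r n j).1).prodMk
      (hasDerivAt_const t (regularRing lam r n j).2)
    refine h2.congr_deriv (Prod.ext ?_ rfl)
    simp only [rotate, hc]
    ring
  · rw [fderiv_hamiltonian fun i j hij => phaseSpace_quadForm_ne hmem hij, Finset.mul_sum]
    refine Finset.sum_congr rfl fun j _ => ?_
    rw [symplecticForm_rotation (hmem.1 j).1 (hw j), sum_bilin_div_quadForm_ring hr hx hc1 j (hw j),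
      hω, ringVelocity]
    ring

end Equilibrium

/-- The Lyapunov function: a combination of the Hamiltonian and of the angular momentum that has a
critical point at the ring. -/
noncomputable def lyapunov (lam r : ℝ) {n : ℕ} (p : Fin n → Amb) : ℝ :=
  -(∑ i, ∑ j ∈ Finset.Ioi i, green lam (p i) (p j))
    + ((n : ℝ) - 1) * (1 - (lam * r ^ 2) ^ 2) / (2 * r ^ 2) * ∑ j, (p j).2

theorem normSq_exp_sub_exp (a b s t : ℝ) :
    Complex.normSq (Complex.exp (a + s * Complex.I) - Complex.exp (b + t * Complex.I))
      = Real.exp a * Real.exp b * (2 * (Real.cosh (a - b) - Real.cos (s - t))) := by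
  have e1 : Real.exp (a - b) = Real.exp a / Real.exp b := Real.exp_sub a b
  have e2 : Real.exp (-(a - b)) = Real.exp b / Real.exp a := by rw [neg_sub, Real.exp_sub]
  rw [Complex.normSq_apply, Real.cosh_eq, Real.cos_sub, e1, e2]
  simp only [Complex.sub_re, Complex.sub_im, Complex.exp_re, Complex.exp_im, Complex.add_re,
    Complex.add_im, Complex.ofReal_re, Complex.ofReal_im, Complex.mul_re, Complex.mul_im,
    Complex.I_re, Complex.I_im, mul_zero, sub_zero, add_zero, zero_add, mul_one]
  have ha := (Real.exp_pos a).ne'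
  have hb := (Real.exp_pos b).ne'
  field_simp
  linear_combination Real.exp a ^ 2 * Real.sin_sq_add_cos_sq s
    + Real.exp b ^ 2 * Real.sin_sq_add_cos_sq t

/-- A vortex in logarithmic polar coordinates relative to the `j`-th vertex of the ring. -/
noncomputable def polarPoint (n : ℕ) (r : ℝ) (j : Fin n) (s t : ℝ) : ℂ :=
  r * root n j * Complex.exp (s + t * Complex.I)

theorem normSq_polarPoint (n : ℕ) (r : ℝ) (j : Fin n) (s t : ℝ) :
    Complex.normSq (polarPoint n r j s t) = r ^ 2 * Real.exp (2 * s) := by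
  rw [polarPoint, Complex.normSq_mul, normSq_mul_root, Complex.normSq_eq_norm_sq, Complex.norm_exp]
  simp [two_mul, Real.exp_add, sq]

theorem normSq_polarPoint_sub (n : ℕ) (r : ℝ) (i j : Fin n) (s t s' t' : ℝ) :
    Complex.normSq (polarPoint n r i s t - polarPoint n r j s' t') =
      r ^ 2 * (Real.exp s * Real.exp s' *
        (2 * (Real.cosh (s - s') - Real.cos (angle n i - angle n j + (t - t'))))) := by
  have h : ∀ (i : Fin n) (s t : ℝ), polarPoint n r i s t
      = r * Complex.exp (s + (angle n i + t : ℝ) * Complex.I) := by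
    intro i s t
    rw [polarPoint, root_eq_exp_angle, mul_assoc, ← Complex.exp_add]
    congr 2
    simp only [angle]
    push_cast
    ring
  rw [h, h, ← mul_sub, Complex.normSq_mul, Complex.normSq_ofReal, normSq_exp_sub_exp,
    add_sub_add_comm]
  ring

/-- The squared chordal distance is `2 r²` times a function of the coordinate differences times one
factor `exp s / (1 + lam |z|²)` for each of the two vortices. Each vortex lies in `n - 1` pairs,
whence the parameter of `radial`. -/
theorem lyapunov_eq_polarLyapunov {n : ℕ} {lam r : ℝ} (hr : 0 < r) {s t : Fin n → ℝ}
    (hs : ∀ j, 0 < 1 + lam * r ^ 2 * Real.exp (2 * s j))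
    (hst : ∀ i j, i < j →
      0 < Real.cosh (s i - s j) - Real.cos (angle n i - angle n j + (t i - t j))) :
    lyapunov lam r (fun j => stereo lam (polarPoint n r j (s j) (t j)))
      = polarLyapunov n (lam * r ^ 2) s t
        - ∑ i : Fin n, ∑ _j ∈ Finset.Ioi i, (Real.log 2 + 2 * Real.log r) := by
  have hs' : ∀ j, 0 < 1 + lam * Complex.normSq (polarPoint n r j (s j) (t j)) := by
    intro j
    rw [normSq_polarPoint, ← mul_assoc]
    exact hs j
  have hgreen : ∀ i, ∀ j ∈ Finset.Ioi i, green lam (stereo lam (polarPoint n r i (s i) (t i)))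
      (stereo lam (polarPoint n r j (s j) (t j))) =
      Real.log (Real.cosh (s i - s j) - Real.cos (angle n i - angle n j + (t i - t j)))
      + (Real.log 2 + 2 * Real.log r)
      + ((s i - Real.log (1 + lam * r ^ 2 * Real.exp (2 * s i)))
      + (s j - Real.log (1 + lam * r ^ 2 * Real.exp (2 * s j)))) := by
    intro i j hij
    have h1 := hst i j (Finset.mem_Ioi.1 hij)
    rw [green_stereo (hs' i) (hs' j), normSq_polarPoint_sub, normSq_polarPoint, normSq_polarPoint,
      ← mul_assoc lam, ← mul_assoc lam, Real.log_div (by positivity) (mul_pos (hs i) (hs j)).ne',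
      Real.log_mul (by positivity) (by positivity), Real.log_mul (by positivity) (by positivity),
      Real.log_mul (by positivity) (by positivity), Real.log_mul (by positivity) (by positivity),
      Real.log_mul (hs i).ne' (hs j).ne', Real.log_pow, Real.log_exp, Real.log_exp]
    push_cast
    ring
  rw [lyapunov, Finset.sum_congr rfl fun i _ => Finset.sum_congr rfl (hgreen i)]
  simp only [Finset.sum_add_distrib]
  have hsum := sum_Ioi_add_eq fun i (_ : Fin n) =>
    s i - Real.log (1 + lam * r ^ 2 * Real.exp (2 * s i))
  simp only [Finset.sum_const, Finset.card_erase_of_mem (Finset.mem_univ _), Finset.card_univ,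
    Fintype.card_fin, nsmul_eq_mul, Finset.sum_add_distrib] at hsum
  have hu : ∀ j, (stereo lam (polarPoint n r j (s j) (t j))).2
      = r ^ 2 * (Real.exp (2 * s j) / (1 + lam * r ^ 2 * Real.exp (2 * s j))) := by
    intro j
    rw [stereo, normSq_polarPoint, ← mul_assoc, mul_div_assoc]
  simp only [hu, polarLyapunov, radial, Finset.sum_add_distrib, ← Finset.mul_sum]
  rcases Nat.eq_zero_or_pos n with rfl | hn
  · simp
  rw [← Finset.mul_sum, Nat.cast_sub hn, Nat.cast_one] at hsum
  simp only [Finset.sum_const, nsmul_eq_mul] at hsum ⊢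
  have hr' := hr.ne'
  have e : ((n : ℝ) - 1) * (1 - (lam * r ^ 2) ^ 2) / (2 * r ^ 2)
      * (r ^ 2 * ∑ i, Real.exp (2 * s i) / (1 + lam * r ^ 2 * Real.exp (2 * s i)))
      = ((n : ℝ) - 1) * (1 - (lam * r ^ 2) ^ 2) / 2
        * ∑ i, Real.exp (2 * s i) / (1 + lam * r ^ 2 * Real.exp (2 * s i)) := by
    field_simp
  rw [e]
  linarith

end VortexRing

/-! ### Strict local minimality of the ring modulo rotations. -/

namespace VortexRing

open Filter

/-- On the surface `1 - lam u` is the reciprocal of `1 + lam |z|²`, so dividing by it is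
stereographic projection. This puts every nearby configuration into the chart. -/
theorem stereo_div {lam : ℝ} {p : Amb} (hp : casimir lam p = 0) (h : 0 < 1 - lam * p.2) :
    stereo lam (p.1 / ((1 - lam * p.2 : ℝ) : ℂ)) = p := by
  have h1 : Complex.normSq (p.1 / ((1 - lam * p.2 : ℝ) : ℂ)) = p.2 / (1 - lam * p.2) := by
    rw [Complex.normSq_div, Complex.normSq_ofReal]
    unfold casimir at hp
    field_simp
    linarith
  have h2 : 1 + lam * (p.2 / (1 - lam * p.2)) = (1 - lam * p.2)⁻¹ := by
    field_simp; ring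
  rw [stereo, h1, h2]
  refine Prod.ext ?_ ?_
  · have : ((1 - lam * p.2 : ℝ) : ℂ) ≠ 0 := Complex.ofReal_ne_zero.2 h.ne'
    rw [Complex.ofReal_inv]
    field_simp
  · rw [div_inv_eq_mul, div_mul_cancel₀ _ h.ne']

/-- Logarithmic polar coordinates relative to the regular ring. -/
noncomputable def logCoord (lam r : ℝ) (n : ℕ) (p : Fin n → Amb) (j : Fin n) : ℂ :=
  Complex.log ((p j).1 / ((1 - lam * (p j).2 : ℝ) : ℂ) / (r * root n j))

theorem polarPoint_logCoord {lam r : ℝ} (hr : 0 < r) {n : ℕ} {p : Fin n → Amb} {j : Fin n}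
    (h : 0 < 1 - lam * (p j).2) (h1 : (p j).1 ≠ 0) :
    polarPoint n r j (logCoord lam r n p j).re (logCoord lam r n p j).im
      = (p j).1 / ((1 - lam * (p j).2 : ℝ) : ℂ) := by
  have h0 : ((1 - lam * (p j).2 : ℝ) : ℂ) ≠ 0 := Complex.ofReal_ne_zero.2 h.ne'
  have hr' : (r : ℂ) * root n j ≠ 0 :=
    mul_ne_zero (Complex.ofReal_ne_zero.2 hr.ne') (root_ne_zero n j)
  rw [polarPoint, Complex.re_add_im, logCoord, Complex.exp_log (div_ne_zero (div_ne_zero h1 h0) hr'),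
    mul_div_cancel₀ _ hr']

theorem one_sub_ring_snd {n : ℕ} {lam r : ℝ} (hx : 0 < 1 + lam * r ^ 2) (j : Fin n) :
    1 - lam * (regularRing lam r n j).2 = (1 + lam * r ^ 2)⁻¹ := by
  rw [regularRing_apply]
  field_simp
  ring

theorem ring_fst_ne_zero {n : ℕ} {lam r : ℝ} (hr : 0 < r) (hx : 0 < 1 + lam * r ^ 2) (j : Fin n) :
    (regularRing lam r n j).1 ≠ 0 := by
  rw [regularRing_apply]
  exact mul_ne_zero (Complex.ofReal_ne_zero.2 (div_pos hr hx).ne') (root_ne_zero n j)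

theorem tendsto_logCoord {n : ℕ} {lam r : ℝ} (hr : 0 < r) (hx : 0 < 1 + lam * r ^ 2) (j : Fin n) :
    Tendsto (fun p => logCoord lam r n p j) (𝓝 (regularRing lam r n)) (𝓝 0) := by
  have h1 : (regularRing lam r n j).1 / ((1 - lam * (regularRing lam r n j).2 : ℝ) : ℂ)
      / (r * root n j) = 1 := by
    rw [one_sub_ring_snd hx, regularRing_apply]
    have hx' : (1 + (lam : ℂ) * r ^ 2) ≠ 0 := by exact_mod_cast hx.ne'
    have hr' : (r : ℂ) ≠ 0 := Complex.ofReal_ne_zero.2 hr.ne'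
    have := root_ne_zero n j
    push_cast
    generalize 1 + (lam : ℂ) * r ^ 2 = X at hx'
    field_simp
  have hc : ContinuousAt (fun p : Fin n → Amb => logCoord lam r n p j) (regularRing lam r n) := by
    unfold logCoord
    refine ContinuousAt.clog ?_ (by rw [h1]; exact Complex.one_mem_slitPlane)
    refine ContinuousAt.div_const (ContinuousAt.div ?_ ?_ ?_) _
    · exact (continuous_fst.comp (continuous_apply j)).continuousAt
    · exact (Complex.continuous_ofReal.comp (by fun_prop)).continuousAt
    · rw [one_sub_ring_snd hx]
      exact Complex.ofReal_ne_zero.2 (inv_pos.2 hx).ne'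
  have h := hc.tendsto
  rwa [logCoord, h1, Complex.log_one] at h

section LocalMinimum

variable {n : ℕ} [NeZero n] {lam r : ℝ}

/-- The regular ring is, up to rotations, a strict local minimum of the Lyapunov function. -/
theorem eventually_eq_rotate_ring (hr : 0 < r) (hx : 0 < 1 + lam * r ^ 2)
    (h : (⌊(n : ℝ) ^ 2 / 4⌋ : ℝ)
      < 2 * ((n : ℝ) - 1) * ((1 + (lam * r ^ 2) ^ 2) / (1 + lam * r ^ 2) ^ 2)) :
    ∀ᶠ p in 𝓝 (regularRing lam r n), (∀ j, casimir lam (p j) = 0) →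
      lyapunov lam r p ≤ lyapunov lam r (regularRing lam r n) →
      ∃ t : ℝ, p = rotate (Complex.exp (t * Complex.I)) (regularRing lam r n) := by
  obtain ⟨c, hc, hmin⟩ := eventually_polarLyapunov_le hx h
  have hpos : ∀ᶠ y in 𝓝 (0 : (Fin n → ℝ) × (Fin n → ℝ)),
      (∀ j, 0 < 1 + lam * r ^ 2 * Real.exp (2 * y.1 j)) ∧ ∀ i, ∀ j ∈ Finset.Ioi i,
      0 < Real.cosh (y.1 i - y.1 j) - Real.cos (angle n i - angle n j + (y.2 i - y.2 j)) := by
    refine (eventually_all.2 fun j => ?_).and (eventually_all.2 fun i =>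
      (Filter.eventually_all_finset _).2 fun j hj => ?_)
    · have hcont : Continuous fun y : (Fin n → ℝ) × (Fin n → ℝ) =>
        1 + lam * r ^ 2 * Real.exp (2 * y.1 j) := by fun_prop
      exact hcont.continuousAt.eventually (lt_mem_nhds (by simpa using hx))
    · have hcont : Continuous fun y : (Fin n → ℝ) × (Fin n → ℝ) => Real.cosh (y.1 i - y.1 j)
          - Real.cos (angle n i - angle n j + (y.2 i - y.2 j)) := by
        have := Real.continuous_cosh
        fun_prop
      exact hcont.continuousAt.eventually
        (lt_mem_nhds (by simpa using cos_angle_sub_lt (Finset.mem_Ioi.1 hj).ne))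
  have hcoord : Tendsto (fun p => ((fun j => (logCoord lam r n p j).re),
      fun j => (logCoord lam r n p j).im)) (𝓝 (regularRing lam r n))
      (𝓝 (0 : (Fin n → ℝ) × (Fin n → ℝ))) := by
    have h1 : Tendsto (fun p j => (logCoord lam r n p j).re) (𝓝 (regularRing lam r n))
        (𝓝 (0 : Fin n → ℝ)) := tendsto_pi_nhds.2 fun j => by
      exact (Complex.continuous_re.tendsto' 0 0 rfl).comp (tendsto_logCoord hr hx j)
    have h2 : Tendsto (fun p j => (logCoord lam r n p j).im) (𝓝 (regularRing lam r n))
        (𝓝 (0 : Fin n → ℝ)) := tendsto_pi_nhds.2 fun j => by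
      exact (Complex.continuous_im.tendsto' 0 0 rfl).comp (tendsto_logCoord hr hx j)
    exact h1.prodMk_nhds h2
  have hdom : ∀ᶠ p in 𝓝 (regularRing lam r n), ∀ j, 0 < 1 - lam * (p j).2 ∧ (p j).1 ≠ 0 := by
    refine eventually_all.2 fun j => Eventually.and ?_ ?_
    · have hcont : Continuous fun p : Fin n → Amb => 1 - lam * (p j).2 := by fun_prop
      exact hcont.continuousAt.eventually
        (lt_mem_nhds ((inv_pos.2 hx).trans_eq (one_sub_ring_snd hx j).symm))
    · have hcont : Continuous fun p : Fin n → Amb => (p j).1 := by fun_prop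
      exact hcont.continuousAt.eventually_ne (ring_fst_ne_zero hr hx j)
  have hring : lyapunov lam r (regularRing lam r n) = polarLyapunov n (lam * r ^ 2) 0 0
      - ∑ i : Fin n, ∑ _j ∈ Finset.Ioi i, (Real.log 2 + 2 * Real.log r) := by
    refine Eq.trans (congrArg (lyapunov lam r) ?_) (lyapunov_eq_polarLyapunov (s := 0) (t := 0) hr
      hpos.self_of_nhds.1 fun i j hij => hpos.self_of_nhds.2 i j (Finset.mem_Ioi.2 hij))
    funext j
    simp [polarPoint, regularRing]
  filter_upwards [hcoord.eventually hmin, hcoord.eventually hpos, hdom] with p h1 h2 h3 hcas hle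
  have hp : p = fun j => stereo lam
      (polarPoint n r j (logCoord lam r n p j).re (logCoord lam r n p j).im) := by
    funext j
    rw [polarPoint_logCoord hr (h3 j).1 (h3 j).2, stereo_div (hcas j) (h3 j).1]
  have hlyap := lyapunov_eq_polarLyapunov (n := n) hr h2.1
    fun i j hij => h2.2 i j (Finset.mem_Ioi.2 hij)
  rw [← hp] at hlyap
  rw [hlyap, hring] at hle
  set s : Fin n → ℝ := fun j => (logCoord lam r n p j).re with hs
  set t : Fin n → ℝ := fun j => (logCoord lam r n p j).im with ht
  have hs0 : 0 ≤ ∑ j, s j ^ 2 := Finset.sum_nonneg fun j _ => sq_nonneg _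
  have ht0 : ∀ i, 0 ≤ ∑ j ∈ Finset.Ioi i, (t i - t j) ^ 2 / 8 :=
    fun i => Finset.sum_nonneg fun j _ => by positivity
  have ht1 : 0 ≤ ∑ i, ∑ j ∈ Finset.Ioi i, (t i - t j) ^ 2 / 8 :=
    Finset.sum_nonneg fun i _ => ht0 i
  -- The Lyapunov value does not exceed that of the ring, so both nonnegative remainders vanish: all
  -- `s j` are zero and all `t j` coincide, which is a rotation of the ring.
  have hs2 : ∑ j, s j ^ 2 = 0 := by nlinarith
  have ht2 : ∑ i, ∑ j ∈ Finset.Ioi i, (t i - t j) ^ 2 / 8 = 0 := by nlinarith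
  have hs3 : ∀ j, s j = 0 := fun j => by
    simpa using (Finset.sum_eq_zero_iff_of_nonneg fun j _ => sq_nonneg _).1 hs2 j
      (Finset.mem_univ j)
  have ht3 : ∀ j, t j = t 0 := by
    intro j
    rcases eq_or_ne j 0 with rfl | hj
    · rfl
    have h4 := (Finset.sum_eq_zero_iff_of_nonneg fun i _ => ht0 i).1 ht2 0 (Finset.mem_univ _)
    have h5 := (Finset.sum_eq_zero_iff_of_nonneg
      fun j _ => by positivity).1 h4 j (Finset.mem_Ioi.2 (Fin.pos_iff_ne_zero.2 hj))
    have h6 : (t 0 - t j) ^ 2 = 0 := by linarith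
    linarith [pow_eq_zero_iff two_ne_zero |>.1 h6]
  refine ⟨t 0, ?_⟩
  rw [hp]
  funext j
  change stereo lam (polarPoint n r j (s j) (t j)) = _
  rw [hs3, ht3, rotate, regularRing, stereo, normSq_polarPoint, stereo, normSq_mul_root, polarPoint]
  simp only [mul_zero, Real.exp_zero, mul_one, Complex.ofReal_zero, zero_add]
  refine Prod.ext ?_ rfl
  simp only
  ring

end LocalMinimum

/-! ### The momentum of the ring and its stabilizer. -/

theorem sum_root {n : ℕ} (hn : 2 ≤ n) : ∑ j, root n j = 0 := by
  have h := (Complex.isPrimitiveRoot_exp n (by omega)).geom_sum_eq_zero (by omega)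
  rw [← h, ← Fin.sum_univ_eq_sum_range]
  exact Finset.sum_congr rfl fun j _ => root_eq_pow n j

theorem momentum_ring {n : ℕ} (hn : 2 ≤ n) (lam κ r : ℝ) :
    momentum (fun _ : Fin n => κ) (regularRing lam r n)
      = (n * κ) • ((0, r ^ 2 / (1 + lam * r ^ 2)) : Amb) := by
  have h : ∀ j : Fin n, κ • regularRing lam r n j
      = ((κ * (r / (1 + lam * r ^ 2)) : ℝ) * root n j, κ * (r ^ 2 / (1 + lam * r ^ 2))) := by
    intro j
    rw [regularRing_apply]
    refine Prod.ext ?_ rfl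
    simp
    ring
  rw [momentum, Finset.sum_congr rfl fun j _ => h j]
  refine Prod.ext ?_ ?_
  · rw [Prod.fst_sum]
    simp only [← Finset.mul_sum, sum_root hn]
    simp
  · rw [Prod.snd_sum]
    simp
    ring

/-- The symmetries that fix a point of the `u`-axis other than the centre of the surface are the
rotations about the axis. -/
theorem eq_rotation_of_mem_symmetryGroup {lam u₀ : ℝ} (hu : 2 * lam * u₀ - 1 ≠ 0)
    {A : Amb ≃ᵃ[ℝ] Amb} (hA : A ∈ symmetryGroup lam) (hfix : A (0, u₀) = (0, u₀)) :
    ∃ c : ℂ, Complex.normSq c = 1 ∧ ∀ p, A p = (c * p.1, p.2) := by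
  obtain ⟨hcas, hdet, -⟩ := hA
  set L : Amb →ₗ[ℝ] Amb := (A.linear : Amb →ₗ[ℝ] Amb) with hL
  have hAv : ∀ v, A (v + (0, u₀)) = L v + (0, u₀) := by
    intro v
    have := A.map_vadd (0, u₀) v
    rwa [hfix] at this
  have hexp : ∀ v : Amb, casimir lam (v + (0, u₀))
      = casimir lam (0, u₀) + quadForm lam v + (2 * lam * u₀ - 1) * v.2 := by
    intro v
    simp [casimir, quadForm]
    ring
  have hq : ∀ v, quadForm lam (L v) + (2 * lam * u₀ - 1) * (L v).2
      = quadForm lam v + (2 * lam * u₀ - 1) * v.2 := by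
    intro v
    have := hcas (v + (0, u₀))
    rw [hAv, hexp, hexp] at this
    linarith
  -- Comparing `v` with `-v` separates the odd linear term from the even quadratic one; the linear
  -- term has a nonzero coefficient because the fixed point is not the centre.
  have hsnd : ∀ v, (L v).2 = v.2 := by
    intro v
    have h1 := hq v
    have h2 := hq (-v)
    rw [map_neg, quadForm_neg, quadForm_neg, Prod.snd_neg, Prod.snd_neg] at h2
    exact mul_left_cancel₀ hu (by linarith)
  have hfst : ∀ v, Complex.normSq (L v).1 = Complex.normSq v.1 := by
    intro v
    have h1 := hq v
    simp only [quadForm, hsnd] at h1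
    linarith
  set g : ℂ →ₗ[ℝ] ℂ := LinearMap.fst ℝ ℂ ℝ ∘ₗ L ∘ₗ LinearMap.inl ℝ ℂ ℝ with hg
  have hLg : L = g.prodMap LinearMap.id := by
    refine LinearMap.ext fun v => Prod.ext ?_ (hsnd v)
    have h1 : v = (v.1, 0) + (0, v.2) := by simp
    have h2 : (L (0, v.2)).1 = 0 := by
      rw [← Complex.normSq_eq_zero, hfst]; simp
    conv_lhs => rw [h1, map_add, Prod.fst_add, h2, add_zero]
    rfl
  have hgn : ∀ z, Complex.normSq (g z) = Complex.normSq z := fun z => hfst (z, 0)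
  have hgz : ∀ z : ℂ, g z = z.re * g 1 + z.im * g Complex.I := by
    intro z
    have h1 : z = z.re • (1 : ℂ) + z.im • Complex.I := by simp [Complex.re_add_im]
    conv_lhs => rw [h1, map_add, map_smul, map_smul]
    simp
  rw [hLg, LinearMap.det_prodMap, LinearMap.det_id, mul_one,
    ← LinearMap.det_toMatrix Complex.basisOneI, Matrix.det_fin_two] at hdet
  simp [LinearMap.toMatrix_apply] at hdet
  have h1 := hgn 1
  have h2 := hgn Complex.I
  have h3 := hgn (1 + Complex.I)
  rw [map_add] at h3
  simp [Complex.normSq_apply] at h1 h2 h3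
  -- For a norm-preserving `g`, `|g I - I * g 1|²` equals `2 - 2 det g`, which is zero; so `g` is
  -- complex linear.
  have hI : g Complex.I = Complex.I * g 1 := by
    refine Complex.ext ?_ ?_
    · simp
      nlinarith [sq_nonneg ((g Complex.I).re + (g 1).im), sq_nonneg ((g Complex.I).im - (g 1).re)]
    · simp
      nlinarith [sq_nonneg ((g Complex.I).re + (g 1).im), sq_nonneg ((g Complex.I).im - (g 1).re)]
  refine ⟨g 1, by rw [hgn]; simp, fun p => ?_⟩
  have h4 := hAv (p - (0, u₀))
  rw [sub_add_cancel] at h4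
  rw [h4, hLg]
  refine Prod.ext ?_ ?_
  · simp only [LinearMap.prodMap_apply, Prod.fst_add, Prod.fst_sub, sub_zero, add_zero]
    rw [hgz, hI]
    conv_rhs => rw [← Complex.re_add_im p.1]
    ring
  · simp

/-- The momentum is `n κ` times the centroid of the ring, so stabilizing it means fixing the
centroid. The centroid is the centre of the surface only if `lam r² = 1`. -/
theorem eq_rotation_of_momentumAction {n : ℕ} (hn : 2 ≤ n) {lam κ r : ℝ} (hκ : κ ≠ 0)
    (hx : 0 < 1 + lam * r ^ 2) (hx1 : lam * r ^ 2 ≠ 1) {A : Amb ≃ᵃ[ℝ] Amb}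
    (hA : A ∈ symmetryGroup lam)
    (hμ : momentumAction (fun _ : Fin n => κ) A (momentum (fun _ => κ) (regularRing lam r n))
      = momentum (fun _ => κ) (regularRing lam r n)) :
    ∃ c : ℂ, Complex.normSq c = 1 ∧ ∀ p, A p = (c * p.1, p.2) := by
  refine eq_rotation_of_mem_symmetryGroup (u₀ := r ^ 2 / (1 + lam * r ^ 2)) ?_ hA ?_
  · intro h
    field_simp at h
    exact hx1 (by linarith)
  · rw [momentum_ring hn, momentumAction] at hμ
    simp only [Finset.sum_const, Finset.card_univ, Fintype.card_fin, nsmul_eq_mul, map_smul,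
      ← smul_add] at hμ
    have hnκ : (n * κ : ℝ) ≠ 0 := mul_ne_zero (by positivity) hκ
    have h1 := smul_right_injective Amb hnκ hμ
    have h2 := A.map_vadd 0 ((0, r ^ 2 / (1 + lam * r ^ 2)) : Amb)
    simp only [vadd_eq_add, add_zero] at h2
    exact h2.trans h1

end VortexRing

/-! ### Rotation orbits and compact tubes around them. -/

namespace VortexRing

open Filter Metric

theorem normSq_eq_one_iff {c : ℂ} : Complex.normSq c = 1 ↔ ‖c‖ = 1 := by
  rw [Complex.normSq_eq_norm_sq, pow_eq_one_iff_of_nonneg (norm_nonneg c) two_ne_zero]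

section Rotation

variable {n : ℕ}

theorem rotate_rotate (a b : ℂ) (p : Fin n → Amb) : rotate a (rotate b p) = rotate (a * b) p := by
  funext j; simp [rotate, mul_assoc]

theorem rotate_one (p : Fin n → Amb) : rotate 1 p = p := by
  funext j; simp [rotate]

theorem dist_rotate {c : ℂ} (hc : ‖c‖ = 1) (p q : Fin n → Amb) :
    dist (rotate c p) (rotate c q) = dist p q := by
  have h : ∀ j, nndist (rotate c p j) (rotate c q j) = nndist (p j) (q j) := fun j => by
    apply NNReal.eq
    rw [coe_nndist, coe_nndist, Prod.dist_eq, Prod.dist_eq]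
    simp only [rotate, dist_eq_norm, ← mul_sub, norm_mul, hc, one_mul]
  rw [dist_pi_def, dist_pi_def]
  simp only [h]

theorem quadForm_rotate {lam : ℝ} {c : ℂ} (hc : ‖c‖ = 1) (p : Fin n → Amb) (i j : Fin n) :
    quadForm lam (rotate c p i - rotate c p j) = quadForm lam (p i - p j) := by
  simp only [quadForm, rotate, Prod.fst_sub, Prod.snd_sub, ← mul_sub, Complex.normSq_mul,
    normSq_eq_one_iff.2 hc, one_mul]

theorem casimir_rotate {lam : ℝ} {c : ℂ} (hc : ‖c‖ = 1) (p : Fin n → Amb) (j : Fin n) :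
    casimir lam (rotate c p j) = casimir lam (p j) := by
  simp only [casimir, rotate, Complex.normSq_mul, normSq_eq_one_iff.2 hc, one_mul]

theorem rotate_mem_phaseSpace {lam : ℝ} {c : ℂ} (hc : ‖c‖ = 1) {p : Fin n → Amb}
    (hp : p ∈ phaseSpace lam n) : rotate c p ∈ phaseSpace lam n := by
  refine ⟨fun j => ⟨(casimir_rotate hc p j).trans (hp.1 j).1, (hp.1 j).2⟩, fun i j hij => ?_⟩
  have hc0 : c ≠ 0 := norm_ne_zero_iff.1 (by rw [hc]; exact one_ne_zero)
  exact hp.2 (Prod.ext (mul_left_cancel₀ hc0 (congrArg Prod.fst hij)) (congrArg Prod.snd hij :))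

theorem lyapunov_rotate {lam r : ℝ} {c : ℂ} (hc : ‖c‖ = 1) (p : Fin n → Amb) :
    lyapunov lam r (rotate c p) = lyapunov lam r p := by
  simp only [lyapunov, green, quadForm_rotate hc]
  rfl

/-- The orbit of a configuration under the rotations about the `u`-axis. -/
def orbit (p : Fin n → Amb) : Set (Fin n → Amb) := (fun c => rotate c p) '' sphere 0 1

theorem mem_orbit {p q : Fin n → Amb} : q ∈ orbit p ↔ ∃ c : ℂ, ‖c‖ = 1 ∧ rotate c p = q := by
  simp [orbit]

theorem isCompact_orbit (p : Fin n → Amb) : IsCompact (orbit p) := by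
  refine (isCompact_sphere 0 1).image ?_
  refine continuous_pi fun j => ?_
  unfold rotate
  fun_prop

theorem orbit_nonempty (p : Fin n → Amb) : (orbit p).Nonempty :=
  ⟨p, mem_orbit.2 ⟨1, norm_one, rotate_one p⟩⟩

theorem infDist_rotate_le {c : ℂ} (hc : ‖c‖ = 1) (p q : Fin n → Amb) :
    infDist (rotate c q) (orbit p) ≤ infDist q (orbit p) := by
  obtain ⟨y, hy, hd⟩ := (isCompact_orbit p).exists_infDist_eq_dist (orbit_nonempty p) q
  obtain ⟨a, ha, rfl⟩ := mem_orbit.1 hy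
  rw [hd, ← dist_rotate hc]
  refine infDist_le_dist_of_mem (mem_orbit.2 ⟨c * a, by simp [hc, ha], ?_⟩)
  rw [rotate_rotate]

/-- The closed tubes around the orbit of a configuration. -/
def tube (p : Fin n → Amb) (ε : ℝ) : Set (Fin n → Amb) := {q | infDist q (orbit p) ≤ ε}

theorem tube_subset_cthickening (p : Fin n → Amb) (ε : ℝ) :
    tube p ε ⊆ cthickening ε (orbit p) := by
  intro q hq
  obtain ⟨y, hy, hd⟩ := (isCompact_orbit p).exists_infDist_eq_dist (orbit_nonempty p) q
  exact mem_cthickening_of_dist_le q y ε _ hy (hd ▸ hq)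

theorem isCompact_tube (p : Fin n → Amb) (ε : ℝ) : IsCompact (tube p ε) :=
  (isCompact_orbit p).cthickening.of_isClosed_subset
    (isClosed_le (continuous_infDist_pt _) continuous_const) (tube_subset_cthickening p ε)

end Rotation

/-! ### Conservation of the Lyapunov function. -/

section Lyapunov

variable {n : ℕ} {lam r κ : ℝ}

theorem lyapunov_eq_hamiltonian (hκ : κ ≠ 0) (p : Fin n → Amb) :
    lyapunov lam r p = 4 * Real.pi / κ ^ 2 * hamiltonian lam (fun _ => κ) p
      + ((n : ℝ) - 1) * (1 - (lam * r ^ 2) ^ 2) / (2 * r ^ 2) * ∑ j, (p j).2 := by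
  have hπ := Real.pi_ne_zero
  simp only [lyapunov, hamiltonian, mul_assoc, ← Finset.mul_sum]
  field_simp

theorem continuousAt_lyapunov {p : Fin n → Amb} (hp : p ∈ noCollision lam n) :
    ContinuousAt (lyapunov lam r) p := by
  obtain ⟨L, hL, -⟩ := hasFDerivAt_hamiltonian (fun _ => 1) hp
  have h : (lyapunov lam r : (Fin n → Amb) → ℝ) = fun p => _ := funext fun p =>
    lyapunov_eq_hamiltonian (lam := lam) (r := r) one_ne_zero p
  rw [h]
  have h2 : Continuous fun p : Fin n → Amb => ∑ j, (p j).2 := by fun_prop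
  exact (continuousAt_const.mul hL.continuousAt).add (continuousAt_const.mul h2.continuousAt)

/-- Only the direction of the velocity matters, so the factor `c` is allowed; it covers the cut-off
field as well as genuine trajectories. -/
theorem hasDerivAt_lyapunov (hκ : κ ≠ 0) {γ : ℝ → Fin n → Amb} {v : Fin n → Amb} {c t : ℝ}
    (hγ : HasDerivAt γ (c • v) t) (hcas : ∀ j, casimir lam (γ t j) = 0)
    (hq : γ t ∈ noCollision lam n) (hv : IsHamiltonianVector lam κ (γ t) v) :
    HasDerivAt (fun s => lyapunov lam r (γ s)) 0 t := by
  obtain ⟨L, hL, -⟩ := hasFDerivAt_hamiltonian (fun _ => κ) hq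
  have hLv : L v = 0 := by rw [← hL.fderiv]; exact hv.fderiv_self
  have h1 := hL.comp_hasDerivAt t hγ
  have h2 : HasDerivAt (fun s => ∑ j, (γ s j).2) (∑ j, ((c • v) j).2) t :=
    HasDerivAt.fun_sum fun j _ =>
      (ContinuousLinearMap.snd ℝ ℂ ℝ).hasFDerivAt.comp_hasDerivAt t (hasDerivAt_pi.1 hγ j)
  have h3 : ∑ j, ((c • v) j).2 = 0 := by
    simp only [Pi.smul_apply, Prod.smul_snd, smul_eq_mul, ← Finset.mul_sum,
      hv.sum_snd hκ hcas hq, mul_zero]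
  have h := (h1.const_mul (4 * Real.pi / κ ^ 2)).add
    (h2.const_mul (((n : ℝ) - 1) * (1 - (lam * r ^ 2) ^ 2) / (2 * r ^ 2)))
  rw [h3, map_smul, hLv] at h
  have hf : (fun s => lyapunov lam r (γ s)) = fun s => _ := funext fun s =>
    lyapunov_eq_hamiltonian (lam := lam) (r := r) hκ (γ s)
  rw [hf]
  exact h.congr_deriv (by simp)

/-- The Lyapunov function is a constant of the motion. -/
theorem lyapunov_eq_of_isTrajectory (hκ : κ ≠ 0) {I : Set ℝ} {γ : ℝ → Fin n → Amb} (hIo : IsOpen I)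
    (hI : I.OrdConnected) (hγ : IsTrajectory lam (fun _ => κ) I γ) {s t : ℝ} (hs : s ∈ I)
    (ht : t ∈ I) : lyapunov lam r (γ t) = lyapunov lam r (γ s) := by
  refine eq_of_hasDerivAt_zero hIo hI (f := fun s => lyapunov lam r (γ s)) (fun t ht => ?_) hs ht
  obtain ⟨hmem, v, hv, hham⟩ := hγ t ht
  refine hasDerivAt_lyapunov (c := 1) (v := v) hκ (by rwa [one_smul]) (fun j => (hmem.1 j).1)
    (fun i j hij => phaseSpace_quadForm_ne hmem hij) ⟨fun j => ?_, hham⟩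
  refine isTangent_of_hasDerivAt (hasDerivAt_pi.1 hv j) ?_
  filter_upwards [hIo.mem_nhds ht] with s hs
  exact ((hγ s hs).1.1 j).1

end Lyapunov

/-! ### Trapping in a tube and existence for all time. -/

section Trapping

variable {n : ℕ} {lam r κ ε m : ℝ} {p₀ : Fin n → Amb}

/-- A curve on which the Lyapunov function is constant does not leave a tube, if it starts where
the Lyapunov function is smaller than on the boundary of the tube. -/
theorem infDist_lt_of_lyapunov_const
    (hm : ∀ p, infDist p (orbit p₀) = ε → (∀ j, casimir lam (p j) = 0) → m ≤ lyapunov lam r p)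
    {I : Set ℝ} (hI : I.OrdConnected) {γ : ℝ → Fin n → Amb} (hγ : ContinuousOn γ I)
    (hcas : ∀ t ∈ I, ∀ j, casimir lam (γ t j) = 0)
    (hconst : ∀ t ∈ I, lyapunov lam r (γ t) = lyapunov lam r (γ 0)) (h0 : 0 ∈ I)
    (hd : infDist (γ 0) (orbit p₀) < ε) (hl : lyapunov lam r (γ 0) < m) :
    ∀ t ∈ I, infDist (γ t) (orbit p₀) < ε := by
  refine lt_of_forall_ne hI ((continuous_infDist_pt _).comp_continuousOn hγ) h0 hd
    fun t ht hε => ?_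
  have h := hm (γ t) hε (hcas t ht)
  rw [hconst t ht] at h
  exact absurd hl (not_lt.2 h)

/-- The trajectories that start in a tube, where the Lyapunov function is smaller than on the
boundary of the tube, exist for all time. -/
theorem exists_isTrajectory (hκ : κ ≠ 0) (hK : tube p₀ ε ⊆ noCollision lam n)
    (hu : ∀ p ∈ tube p₀ ε, ∀ j, 0 ≤ (p j).2)
    (hm : ∀ p, infDist p (orbit p₀) = ε → (∀ j, casimir lam (p j) = 0) → m ≤ lyapunov lam r p)
    {p : Fin n → Amb} (hp : p ∈ phaseSpace lam n) (hd : infDist p (orbit p₀) < ε)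
    (hl : lyapunov lam r p < m) :
    ∃ γ, IsTrajectory lam (fun _ => κ) Set.univ γ ∧ γ 0 = p := by
  obtain ⟨γ, c, hγ0, hγ, hc, hO⟩ := exists_cutoff_solution (isOpen_noCollision lam n)
    (isCompact_tube p₀ ε) hK (contDiffOn_vectorField lam κ) (x := p) hd.le
  have hcas : ∀ t j, casimir lam (γ t j) = 0 := by
    intro t j
    have h : ∀ s ∈ Set.univ, HasDerivAt (fun s => casimir lam (γ s j)) 0 s := by
      intro s _
      refine hasDerivAt_casimir (hasDerivAt_pi.1 (hγ s) j) ?_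
      -- The one-term sum expresses that a scalar multiple of a tangent vector is tangent.
      have h1 := isTangent_sum (Finset.univ : Finset Unit) (fun _ => c s)
        (v := fun _ => vectorField lam κ (γ s) j) (lam := lam) (p := γ s j)
        fun _ _ => isTangent_sum _ _ fun i _ => isTangent_turn lam _ _
      simpa using h1
    rw [eq_of_hasDerivAt_zero isOpen_univ Set.ordConnected_univ h (Set.mem_univ 0)
      (Set.mem_univ t), hγ0]
    exact (hp.1 j).1
  have hconst : ∀ t, lyapunov lam r (γ t) = lyapunov lam r (γ 0) := fun t =>
    eq_of_hasDerivAt_zero isOpen_univ Set.ordConnected_univ (fun s _ => hasDerivAt_lyapunov hκ (hγ s)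
      (hcas s) (hO s) (isHamiltonianVector_vectorField (hcas s) (hO s))) (Set.mem_univ 0)
      (Set.mem_univ t)
  -- The cut-off solution is trapped in the tube too. There the cut-off factor is `1`, so it solves
  -- the original equations.
  have hcont : Continuous γ := continuous_iff_continuousAt.2 fun t => (hγ t).continuousAt
  have htrap := infDist_lt_of_lyapunov_const hm Set.ordConnected_univ hcont.continuousOn
    (fun t _ => hcas t) (fun t _ => hconst t) (Set.mem_univ 0) (by rwa [hγ0]) (by rwa [hγ0])
  refine ⟨γ, fun t _ => ?_, hγ0⟩
  have htube : γ t ∈ tube p₀ ε := (htrap t (Set.mem_univ t)).le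
  refine ⟨⟨fun j => ⟨hcas t j, fun _ => hu _ htube j⟩, fun i j hij => ?_⟩,
    vectorField lam κ (γ t), ?_, (isHamiltonianVector_vectorField (hcas t) (hO t)).2⟩
  · by_contra hne
    exact hO t i j hne (by rw [hij, sub_self]; simp [quadForm])
  · have h := hγ t
    rwa [hc t htube, one_smul] at h

end Trapping

/-! ### Lyapunov stability of the ring. -/

section Ring

variable {n : ℕ} {lam r κ : ℝ}

/-- The ring minimizes the Lyapunov function strictly in a tube, up to rotations. -/
theorem exists_tube_lt_lyapunov [NeZero n] (hr : 0 < r) (hx : 0 < 1 + lam * r ^ 2)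
    (h : (⌊(n : ℝ) ^ 2 / 4⌋ : ℝ)
      < 2 * ((n : ℝ) - 1) * ((1 + (lam * r ^ 2) ^ 2) / (1 + lam * r ^ 2) ^ 2)) :
    ∃ ε > 0, ∀ p, infDist p (orbit (regularRing lam r n)) < ε → (∀ j, casimir lam (p j) = 0) →
      p ∉ orbit (regularRing lam r n) →
      lyapunov lam r (regularRing lam r n) < lyapunov lam r p := by
  obtain ⟨ε, hε, hball⟩ := Metric.eventually_nhds_iff.1 (eventually_eq_rotate_ring hr hx h)
  refine ⟨ε, hε, fun p hp hcas hporb => ?_⟩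
  by_contra hle
  -- Rotating the nearest point of the orbit back to the ring reduces the tube to a ball around the
  -- ring, by rotation invariance.
  obtain ⟨y, hy, hd⟩ := (isCompact_orbit (regularRing lam r n)).exists_infDist_eq_dist
    (orbit_nonempty _) p
  obtain ⟨c, hc, rfl⟩ := mem_orbit.1 hy
  have hc0 : c ≠ 0 := norm_ne_zero_iff.1 (by rw [hc]; exact one_ne_zero)
  have hci : ‖c⁻¹‖ = 1 := by rw [norm_inv, hc, inv_one]
  rw [hd, ← dist_rotate hci, rotate_rotate, inv_mul_cancel₀ hc0, rotate_one] at hp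
  obtain ⟨t, ht⟩ := hball hp (fun j => (casimir_rotate hci p j).trans (hcas j))
    (by rw [lyapunov_rotate hci]; exact not_lt.1 hle)
  refine hporb (mem_orbit.2 ⟨c * Complex.exp (t * Complex.I), ?_, ?_⟩)
  · rw [norm_mul, hc, Complex.norm_exp_ofReal_mul_I, one_mul]
  · rw [← rotate_rotate, ← ht, rotate_rotate, mul_inv_cancel₀ hc0, rotate_one]

/-- With nonzero angular velocity the trajectory sweeps out the whole rotation orbit, so
neighbourhoods of the trajectory are neighbourhoods of a compact set and contain a uniform tube. -/
theorem orbit_subset_range_rotating {ω : ℝ} (hω : ω ≠ 0) {p q : Fin n → Amb} (hq : q ∈ orbit p) :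
    ∃ t, rotating ω p t = q := by
  obtain ⟨c, hc, rfl⟩ := mem_orbit.1 hq
  refine ⟨Complex.arg c / ω, ?_⟩
  rw [rotating_eq_rotate, mul_div_cancel₀ _ hω, mul_comm]
  congr 1
  have h := Complex.norm_mul_exp_arg_mul_I c
  rwa [hc, Complex.ofReal_one, one_mul] at h

theorem rotating_mem_orbit (ω : ℝ) (p : Fin n → Amb) (t : ℝ) : rotating ω p t ∈ orbit p :=
  mem_orbit.2 ⟨_, by rw [mul_comm, Complex.norm_exp_ofReal_mul_I], rfl⟩

theorem ringVelocity_ne_zero (hn : 2 ≤ n) (hκ : κ ≠ 0) (hr : 0 < r) (hx : 0 < 1 + lam * r ^ 2)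
    (hx1 : lam * r ^ 2 ≠ 1) : ringVelocity lam κ r n ≠ 0 := by
  have hn1 : (n : ℝ) - 1 ≠ 0 := by
    have : (2 : ℝ) ≤ n := by exact_mod_cast hn
    linarith
  have h1 : 1 - 2 * lam * (r ^ 2 / (1 + lam * r ^ 2)) ≠ 0 := by
    intro h
    field_simp at h
    exact hx1 (by linarith)
  have := Real.pi_ne_zero
  have h2 := (div_pos hr hx).ne'
  unfold ringVelocity
  positivity

theorem isLyapunovStable_ring (hn : 2 ≤ n) (hκ : κ ≠ 0) (hr : 0 < r) (hx : 0 < 1 + lam * r ^ 2)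
    (hx1 : lam * r ^ 2 ≠ 1) (h : (⌊(n : ℝ) ^ 2 / 4⌋ : ℝ)
      < 2 * ((n : ℝ) - 1) * ((1 + (lam * r ^ 2) ^ 2) / (1 + lam * r ^ 2) ^ 2)) :
    IsLyapunovStable lam (fun _ => κ)
      (rotating (ringVelocity lam κ r n) (regularRing lam r n)) := by
  have : NeZero n := ⟨by omega⟩
  set ω := ringVelocity lam κ r n with hω
  set p₀ := regularRing lam r n with hp₀
  have hω0 : ω ≠ 0 := ringVelocity_ne_zero hn hκ hr hx hx1
  have hstart : rotating ω p₀ 0 = p₀ := by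
    rw [rotating_eq_rotate]; simp [rotate_one]
  have horb : ∀ p ∈ orbit p₀, p ∈ phaseSpace lam n := by
    intro p hp
    obtain ⟨c, hc, rfl⟩ := mem_orbit.1 hp
    exact rotate_ring_mem_phaseSpace hr hx (normSq_eq_one_iff.2 hc)
  intro V _ _ hVnhds
  rw [hstart]
  set W : Set (Fin n → Amb) := interior {p | p ∈ phaseSpace lam n → p ∈ V} with hW
  -- Positive heights keep the configurations on the correct sheet when `lam < 0`.
  set P : Set (Fin n → Amb) := {p | ∀ j, 0 < (p j).2} with hP
  have hPo : IsOpen P := by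
    have : P = ⋂ j, {p : Fin n → Amb | 0 < (p j).2} := by ext; simp [hP]
    rw [this]
    exact isOpen_iInter_of_finite fun j => isOpen_lt continuous_const (by fun_prop)
  have hsub : orbit p₀ ⊆ noCollision lam n ∩ P ∩ W := by
    intro p hp
    refine ⟨⟨fun i j hij => phaseSpace_quadForm_ne (horb p hp) hij, fun j => ?_⟩, ?_⟩
    · obtain ⟨c, hc, rfl⟩ := mem_orbit.1 hp
      simp only [rotate, hp₀, regularRing_apply]
      positivity
    · obtain ⟨t, rfl⟩ := orbit_subset_range_rotating hω0 hp
      exact mem_interior_iff_mem_nhds.2 (mem_nhdsWithin_iff_eventually.1 (hVnhds t))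
  obtain ⟨δ, hδ, hδsub⟩ := (isCompact_orbit p₀).exists_cthickening_subset_open
    (((isOpen_noCollision lam n).inter hPo).inter isOpen_interior) hsub
  obtain ⟨ε₁, hε₁, hlocal⟩ := exists_tube_lt_lyapunov hr hx h
  obtain ⟨ε, hε, hεδ, hεε₁⟩ : ∃ ε > 0, ε ≤ δ ∧ ε < ε₁ :=
    ⟨min δ (ε₁ / 2), by positivity, min_le_left _ _, (min_le_right _ _).trans_lt (by linarith)⟩
  have htube : tube p₀ ε ⊆ noCollision lam n ∩ P ∩ W :=
    ((tube_subset_cthickening p₀ ε).trans (cthickening_mono hεδ _)).trans hδsub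
  -- The level `m` is the minimum over the compact part of the tube's boundary that satisfies the
  -- surface equation; if that part is empty, any level above the value at the ring will do.
  obtain ⟨m, hm0, hm⟩ : ∃ m, lyapunov lam r p₀ < m ∧ ∀ p, infDist p (orbit p₀) = ε →
      (∀ j, casimir lam (p j) = 0) → m ≤ lyapunov lam r p := by
    set S : Set (Fin n → Amb) := {p | infDist p (orbit p₀) = ε ∧ ∀ j, casimir lam (p j) = 0} with hS
    have hScl : IsClosed S := by
      have : S = {p | infDist p (orbit p₀) = ε} ∩ ⋂ j, {p | casimir lam (p j) = 0} := by
        ext; simp [hS]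
      rw [this]
      refine (isClosed_eq (continuous_infDist_pt _) continuous_const).inter
        (isClosed_iInter fun j => isClosed_eq ?_ continuous_const)
      exact (continuous_casimir lam).comp (continuous_apply j)
    have hSK : S ⊆ tube p₀ ε := fun p hp => hp.1.le
    have hSc : IsCompact S := (isCompact_tube p₀ ε).of_isClosed_subset hScl hSK
    rcases S.eq_empty_or_nonempty with hemp | hne
    · refine ⟨lyapunov lam r p₀ + 1, by linarith, fun p hp hcas => ?_⟩
      have : p ∈ S := ⟨hp, hcas⟩
      rw [hemp] at this
      exact this.elim
    · obtain ⟨q, hq, hmin⟩ := hSc.exists_isMinOn hne fun p hp =>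
        (continuousAt_lyapunov (r := r) (htube (hSK hp)).1.1).continuousWithinAt
      refine ⟨lyapunov lam r q, hlocal q (hq.1.trans_lt hεε₁) hq.2 fun hq' => ?_,
        fun p hp hcas => hmin ⟨hp, hcas⟩⟩
      have h0 := hq.1
      rw [infDist_zero_of_mem hq'] at h0
      exact hε.ne h0
  have hUV : ∀ p ∈ phaseSpace lam n, infDist p (orbit p₀) < ε → p ∈ V := fun p hp hd =>
    interior_subset (htube (show p ∈ tube p₀ ε from hd.le)).2 hp
  refine ⟨{p | p ∈ phaseSpace lam n ∧ infDist p (orbit p₀) < ε ∧ lyapunov lam r p < m},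
    fun p hp => hUV p hp.1 hp.2.1, ?_, fun t => ?_, fun p hp => ?_, ?_⟩
  · intro A hA hμ p hp
    obtain ⟨c, hc, hAc⟩ := eq_rotation_of_momentumAction hn hκ hx hx1 hA hμ
    have hc' := normSq_eq_one_iff.1 hc
    have : (fun j => A (p j)) = rotate c p := funext fun j => hAc (p j)
    rw [this]
    exact ⟨rotate_mem_phaseSpace hc' hp.1, (infDist_rotate_le hc' _ _).trans_lt hp.2.1,
      by rw [lyapunov_rotate hc']; exact hp.2.2⟩
  · have hmem := rotating_mem_orbit ω p₀ t
    have hl : lyapunov lam r (rotating ω p₀ t) < m := by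
      obtain ⟨c, hc, hcp⟩ := mem_orbit.1 hmem
      rw [← hcp, lyapunov_rotate hc]
      exact hm0
    have h1 : ∀ᶠ p in 𝓝 (rotating ω p₀ t), infDist p (orbit p₀) < ε :=
      (continuous_infDist_pt (orbit p₀)).continuousAt.eventually
        (gt_mem_nhds ((infDist_zero_of_mem hmem).trans_lt hε))
    have h2 : ∀ᶠ p in 𝓝 (rotating ω p₀ t), lyapunov lam r p < m :=
      (continuousAt_lyapunov (hsub hmem).1.1).eventually (gt_mem_nhds hl)
    filter_upwards [self_mem_nhdsWithin, nhdsWithin_le_nhds h1, nhdsWithin_le_nhds h2]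
      with p hp1 hp2 hp3
    exact ⟨hp1, hp2, hp3⟩
  · exact exists_isTrajectory hκ (fun p hp => (htube hp).1.1)
      (fun p hp j => ((htube hp).1.2 j).le) hm hp.1 hp.2.1 hp.2.2
  · intro I γ hIo hI h0 hγ hγ0 t ht
    refine hUV _ (hγ t ht).1 (infDist_lt_of_lyapunov_const hm hI (fun s hs => ?_)
      (fun s hs j => ((hγ s hs).1.1 j).1)
      (fun s hs => lyapunov_eq_of_isTrajectory hκ hIo hI hγ h0 hs) h0 hγ0.2.1 hγ0.2.2 t ht)
    obtain ⟨-, v, hv, -⟩ := hγ s hs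
    exact hv.continuousAt.continuousWithinAt

end Ring

/-! ### From the geodesic radius and the criterion to the theorem. -/

theorem geodesicRadius_injective {lam r s : ℝ} (hr : 0 < r) (hs : 0 < s)
    (hxr : 0 < 1 + lam * r ^ 2) (hxs : 0 < 1 + lam * s ^ 2)
    (h : geodesicRadius lam r = geodesicRadius lam s) : r = s := by
  unfold geodesicRadius at h
  split_ifs at h with h1 h2
  · have hl := (Real.sqrt_pos.2 h1).ne'
    rw [div_left_inj' hl] at h
    exact mul_right_cancel₀ hl (Real.arctan_injective h)
  · exact h
  · have h3 : 0 < -lam := by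
      rcases lt_trichotomy lam 0 with h | h | h
      · linarith
      · exact absurd h h2
      · exact absurd h h1
    have hl := Real.sqrt_pos.2 h3
    rw [div_left_inj' hl.ne'] at h
    have hmem : ∀ t : ℝ, 0 < t → 0 < 1 + lam * t ^ 2 → t * √(-lam) ∈ Set.Ioo (-1 : ℝ) 1 := by
      intro t ht hxt
      have h4 : 0 < t * √(-lam) := mul_pos ht hl
      refine ⟨by linarith, ?_⟩
      rw [← abs_of_pos h4, ← sq_lt_one_iff_abs_lt_one, mul_pow, Real.sq_sqrt h3.le]
      linarith
    exact mul_right_cancel₀ hl.ne' (Real.artanh_injOn (hmem r hr hxr) (hmem s hs hxs) h)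

/-- This is `(n - 2)² ≥ 0` together with integrality of `n - 1`. -/
theorem sub_one_le_floor (n : ℕ) : (n : ℝ) - 1 ≤ (⌊(n : ℝ) ^ 2 / 4⌋ : ℝ) := by
  have : ((n : ℤ) - 1) ≤ ⌊(n : ℝ) ^ 2 / 4⌋ := by
    rw [Int.le_floor]
    push_cast
    nlinarith [sq_nonneg ((n : ℝ) - 2)]
  exact_mod_cast this

/-- The regular ring is a stable relative equilibrium if its radius satisfies the criterion. -/
theorem isStableRelativeEquilibrium_of_isRegularRing {n : ℕ} (hn : 2 ≤ n) {lam κ a r₀ : ℝ}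
    {p : Fin n → Amb} (hκ : κ ≠ 0) (hr₀ : 0 < r₀) (hx : 0 < 1 + lam * r₀ ^ 2)
    (ha : a = geodesicRadius lam r₀) (hp : IsRegularRing lam a p)
    (h : (1 + lam ^ 2 * r₀ ^ 4) / (1 + lam * r₀ ^ 2) ^ 2
      > 1 / (2 * ((n : ℝ) - 1)) * (⌊(n : ℝ) ^ 2 / 4⌋ : ℝ)) :
    IsStableRelativeEquilibrium lam (fun _ => κ) p := by
  obtain ⟨r, hr, hxr, har, hpr⟩ := hp
  obtain rfl : r = r₀ := geodesicRadius_injective hr hr₀ hxr hx (har.symm.trans ha)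
  obtain rfl : p = regularRing lam r n := funext hpr
  have hn2 : (2 : ℝ) ≤ n := by exact_mod_cast hn
  have hn1 : 0 < (n : ℝ) - 1 := by linarith
  have h' : (⌊(n : ℝ) ^ 2 / 4⌋ : ℝ)
      < 2 * ((n : ℝ) - 1) * ((1 + (lam * r ^ 2) ^ 2) / (1 + lam * r ^ 2) ^ 2) := by
    have e : lam ^ 2 * r ^ 4 = (lam * r ^ 2) ^ 2 := by ring
    rw [e, gt_iff_lt, one_div, inv_mul_lt_iff₀ (by positivity)] at h
    exact h
  -- At `lam r² = 1` the criterion would read `⌊n² / 4⌋ < n - 1`.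
  have hx1 : lam * r ^ 2 ≠ 1 := by
    intro hx1
    rw [hx1] at h'
    have := sub_one_le_floor n
    norm_num at h'
    linarith
  have : NeZero n := ⟨by omega⟩
  exact ⟨ringVelocity lam κ r n, isTrajectory_rotating_ring hr hxr,
    isLyapunovStable_ring hn hκ hr hxr hx1 h'⟩

end VortexRing

theorem mainTheorem3 (n : ℕ) (hn : 2 ≤ n) :
    (∀ (lam κ a r₀ : ℝ) (p : Fin n → VortexRing.Amb), κ ≠ 0 →
      0 < r₀ → 0 < 1 + lam * r₀ ^ 2 → a = VortexRing.geodesicRadius lam r₀ →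
      VortexRing.IsRegularRing lam a p →
      (1 + lam ^ 2 * r₀ ^ 4) / (1 + lam * r₀ ^ 2) ^ 2
        > 1 / (2 * ((n : ℝ) - 1)) * (⌊(n : ℝ) ^ 2 / 4⌋ : ℝ) →
      VortexRing.IsStableRelativeEquilibrium lam (fun _ => κ) p) ∧
    (∃ δ : ℝ, 0 < δ ∧ ∀ (lam κ a r₀ : ℝ) (p : Fin n → VortexRing.Amb), κ ≠ 0 → lam < 0 →
      0 < r₀ → -1 < lam * r₀ ^ 2 → lam * r₀ ^ 2 < -1 + δ →
      a = VortexRing.geodesicRadius lam r₀ → VortexRing.IsRegularRing lam a p →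
      VortexRing.IsStableRelativeEquilibrium lam (fun _ => κ) p) := by
  refine ⟨fun lam κ a r₀ p hκ hr₀ hx ha hp h =>
    VortexRing.isStableRelativeEquilibrium_of_isRegularRing hn hκ hr₀ hx ha hp h, ?_⟩
  set c : ℝ := 1 / (2 * ((n : ℝ) - 1)) * (⌊(n : ℝ) ^ 2 / 4⌋ : ℝ) with hc
  have hn2 : (2 : ℝ) ≤ n := by exact_mod_cast hn
  have hc0 : 0 ≤ c := by
    have h1 := VortexRing.sub_one_le_floor n
    have h2 : 0 < (n : ℝ) - 1 := by linarith
    have h3 : (0 : ℝ) ≤ (⌊(n : ℝ) ^ 2 / 4⌋ : ℝ) := by linarith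
    positivity
  -- With `x = lam r₀²`, this `δ` gives `(1 + c) (1 + x) < 1`, hence `c (1 + x)² ≤ ((1 + c) (1 +
  -- x))² < 1 ≤ 1 + x²`.
  refine ⟨1 / (1 + c), by positivity, fun lam κ a r₀ p hκ _ hr₀ hl hu ha hp => ?_⟩
  have hx : 0 < 1 + lam * r₀ ^ 2 := by linarith
  refine VortexRing.isStableRelativeEquilibrium_of_isRegularRing hn hκ hr₀ hx ha hp ?_
  rw [gt_iff_lt, ← hc, lt_div_iff₀ (by positivity)]
  have h1 : (1 + c) * (1 + lam * r₀ ^ 2) < 1 := by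
    rw [← lt_div_iff₀' (by positivity)]
    linarith
  have h2 : ((1 + c) * (1 + lam * r₀ ^ 2)) ^ 2 < 1 := by
    rw [sq_lt_one_iff₀ (by positivity)]
    exact h1
  have h3 : 0 ≤ lam ^ 2 * r₀ ^ 4 := by positivity
  have h4 : c * (1 + lam * r₀ ^ 2) ^ 2 ≤ ((1 + c) * (1 + lam * r₀ ^ 2)) ^ 2 := by
    rw [mul_pow]
    gcongr
    nlinarith
  linarith
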